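/- **Setting.** Let $E$ be a countably Hilbertian nuclear space: a complete Hausdorff real topological vector space whose topology is generated by Hilbertian seminorms $\|\cdot\|_0\le\|\cdot\|_1\le\cdots$ (seminorms induced by positive semidefinite inner products), such that the completion $E_n$ of $(E,\|\cdot\|_n)$ is a separable Hilbert space for every $n\ge 0$, and for every $n$ there is $m>n$ for which the canonical map $E_m\to E_n$ is Hilbert–Schmidt. Let $E_{-n}=E_n'$ with the dual norm $\|\cdot\|_{-n}$, regarded as a subset of the topological dual $E'$, and give $E'$ the strong topology, generated by the seminorms $p_B(f)=\sup_{\phi\in B}|f(\phi)|$, $B\subseteq E$ bounded. Fix $T>0$. For a topological vector space $X$ let $D_X$ be the set of functions $x:[0,T]\to X$ that are right-continuous with left limits, and put $x(0-)=x(0)$. The graph of $x\in D_X$ is $$\gamma_x=\{(z,t)\in X\times[0,T]: z=(1-a)x(t-)+a\,x(t)\text{ for some }a\in[0,1]\},$$ ordered by $(z_1,t_1)\le(z_2,t_2)$ if $t_1<t_2$, or if $t_1=t_2$ and $z_i=(1-a_i)x(t_1-)+a_i\,x(t_1)$ for $i=1,2$ with some $0\le a_1\le a_2\le 1$. Let $\Lambda_x$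 be the set of continuous non-decreasing surjections $[0,1]\to\gamma_x$. For a continuous seminorm $q$ on $X$ put $$d_{q}(x,y)=\inf_{(z_x,t_x)\in\Lambda_x,\,(z_y,t_y)\in\Lambda_y}\ \sup_{s\in[0,1]}\max\{q(z_x(s)-z_y(s)),\,|t_x(s)-t_y(s)|\}.$$ The M1 topology is the one generated by the balls of all the pseudometrics $d_{p_B}$, $B\subseteq E$ bounded, on $D_{E'}$; of $d_{\|\cdot\|_{-n}}$ on $D_{E_{-n}}$; and of $d_{|\cdot|}$ on $D_{\mathbb R}$. A set is called relatively compact if its closure is compact. For $\phi\in E$ and $A\subseteq D_{E'}$ let $\pi^\phi(A)=\{x(\phi):x\in A\}\subseteq D_{\mathbb R}$, where $x(\phi)=(x_t(\phi))_{t\in[0,T]}$. **Theorem.** Let $A\subseteq D_{E'}$. (a) The following are equivalent: 1. $A$ is relatively compact in $(D_{E'},\mathrm{M1})$; 2. for every $\phi\in E$, $\pi^\phi(A)$ is relatively compact in $(D_{\mathbb R},\mathrm{M1})$; 3. there is $n\in\mathbb N$ such that $A\subseteq D_{E_{-n}}$ and $A$ is relatively compact in $(D_{E_{-n}},\mathrm{M1})$.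 (b) The following are equivalent: 1. $A$ is compact in $(D_{E'},\mathrm{M1})$; 2. $A$ is closed in $(D_{E'},\mathrm{M1})$ and, for every $\phi\in E$, $\pi^\phi(A)$ is compact in $(D_{\mathbb R},\mathrm{M1})$; 3. there is $n\in\mathbb N$ such that $A\subseteq D_{E_{-n}}$ and $A$ is compact in $(D_{E_{-n}},\mathrm{M1})$. -/

import Mathlib

open Set Filter Topology

noncomputable section

/-! ### Countably Hilbertian nuclear spaces -/

section Nuclear

variable {E : Type*} [AddCommGroup E] [Module ℝ E]

/-- A seminorm is Hilbertian if it comes from a (positive semidefinite) inner product. -/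
def Seminorm.IsHilbertian (q : Seminorm ℝ E) : Prop :=
  ∃ B : LinearMap.BilinForm ℝ E, (∀ x y, B x y = B y x) ∧ ∀ x, B x x = q x ^ 2

/-- The inner product of a Hilbertian seminorm, recovered from the seminorm by polarisation. -/
def Seminorm.polarInner (q : Seminorm ℝ E) (x y : E) : ℝ :=
  (q (x + y) ^ 2 - q x ^ 2 - q y ^ 2) / 2

theorem Seminorm.polarInner_eq (q : Seminorm ℝ E) (B : LinearMap.BilinForm ℝ E)
    (hs : ∀ x y, B x y = B y x) (hB : ∀ x, B x x = q x ^ 2) (x y : E) :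
    q.polarInner x y = B x y := by
  have h := hB (x + y)
  simp only [map_add, LinearMap.add_apply] at h
  rw [hB x, hB y, hs y x] at h
  unfold Seminorm.polarInner
  linarith

/-- `S` is an orthonormal system for the Hilbertian seminorm `q`. -/
def Seminorm.IsOrthonormalSet (q : Seminorm ℝ E) (S : Set E) : Prop :=
  (∀ e ∈ S, q e = 1) ∧ S.Pairwise fun e f => q.polarInner e f = 0

/-- `E` is a countably Hilbertian nuclear space, with topology generated by the increasing sequence
`‖·‖₀ ≤ ‖·‖₁ ≤ …` of Hilbertian seminorms `p 0 ≤ p 1 ≤ …`.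

`complete` and `hausdorff` say that `E` is the intersection (in general: the projective limit) of
the Hilbert spaces `Eₙ`, the completions of `(E, p n)`. As `E` is dense in `Eₙ`, separability of
`Eₙ`, and the Hilbert-Schmidt property of the canonical map `Eₘ → Eₙ`, are expressed through
elements of `E`: a separable `Eₘ` has an orthonormal basis of elements of `E`, and the
Hilbert-Schmidt norm does not depend on the orthonormal basis. -/
structure IsCountablyHilbertianNuclear [UniformSpace E] [IsUniformAddGroup E]
    (p : ℕ → Seminorm ℝ E) : Prop where
  withSeminorms : WithSeminorms p
  monotone : Monotone p
  hilbertian : ∀ n, (p n).IsHilbertian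
  separable : ∀ n, ∃ S : Set E, S.Countable ∧ ∀ x : E, ∀ ε > 0, ∃ s ∈ S, p n (x - s) < ε
  hilbertSchmidt : ∀ n, ∃ m, n < m ∧
    ∀ S : Set E, (p m).IsOrthonormalSet S → Summable fun e : S => p n (e : E) ^ 2
  complete : CompleteSpace E
  hausdorff : T2Space E

/-- The space `E` with the single seminorm `p n`; its completion is the Hilbert space `Eₙ`. -/
@[nolint unusedArguments]
def PreHilbertLevel (_p : ℕ → Seminorm ℝ E) (_n : ℕ) : Type _ := E

instance (p : ℕ → Seminorm ℝ E) (n : ℕ) : SeminormedAddCommGroup (PreHilbertLevel p n) :=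
  (p n).toAddGroupSeminorm.toSeminormedAddCommGroup

instance (p : ℕ → Seminorm ℝ E) (n : ℕ) : Module ℝ (PreHilbertLevel p n) :=
  inferInstanceAs (Module ℝ E)

instance (p : ℕ → Seminorm ℝ E) (n : ℕ) : NormedSpace ℝ (PreHilbertLevel p n) where
  norm_smul_le a x := (map_smul_eq_mul (p n) a (show E from x)).le

/-- The dual space `E₋ₙ` of `Eₙ` with the dual norm `‖·‖₋ₙ`. A continuous linear functional on `Eₙ`
is the same thing, with the same norm, as one on the dense subspace `(E, p n)`. -/
abbrev NegHilbert (p : ℕ → Seminorm ℝ E) (n : ℕ) : Type _ :=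
  PreHilbertLevel p n →L[ℝ] ℝ

variable [UniformSpace E] [IsUniformAddGroup E] {p : ℕ → Seminorm ℝ E}

/-- The canonical map `E → Eₙ`. -/
def IsCountablyHilbertianNuclear.toLevel (hE : IsCountablyHilbertianNuclear p) (n : ℕ) :
    E →L[ℝ] PreHilbertLevel p n where
  toFun x := x
  map_add' _ _ := rfl
  map_smul' _ _ := rfl
  cont := by
    let f : E →+ PreHilbertLevel p n :=
      { toFun := fun x => x, map_zero' := rfl, map_add' := fun _ _ => rfl }
    have hf : ContinuousAt f 0 := by
      have h := ((hE.withSeminorms.continuous_seminorm n).tendsto 0)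
      rw [map_zero] at h
      rw [ContinuousAt, map_zero, tendsto_zero_iff_norm_tendsto_zero]
      exact h
    exact continuous_of_continuousAt_zero f hf

/-- The inclusion `E₋ₙ ⊆ E'`, where `E'` carries the strong topology (Mathlib's topology on
`E →L[ℝ] ℝ`, uniform convergence on bounded sets). -/
def IsCountablyHilbertianNuclear.dualInclusion (hE : IsCountablyHilbertianNuclear p) (n : ℕ) :
    NegHilbert p n →L[ℝ] (E →L[ℝ] ℝ) :=
  ContinuousLinearMap.precomp ℝ (hE.toLevel n)

theorem IsCountablyHilbertianNuclear.dualInclusion_apply (hE : IsCountablyHilbertianNuclear p)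
    (n : ℕ) (f : NegHilbert p n) (φ : E) :
    hE.dualInclusion n f φ = f (show PreHilbertLevel p n from φ) := rfl

end Nuclear

/-! ### Càdlàg paths and the M1 topology -/

section Skorokhod

/-- The space `D_X` of càdlàg paths `[0,T] → X`: right-continuous functions with left limits. -/
structure CadlagPath (T : ℝ) (X : Type*) [TopologicalSpace X] where
  toFun : Icc (0 : ℝ) T → X
  rightCont : ∀ t, ContinuousWithinAt toFun (Ici t) t
  leftLimits : ∀ t, ∃ l, Tendsto toFun (𝓝[<] t) (𝓝 l)

variable {T : ℝ}

instance {X : Type*} [TopologicalSpace X] : CoeFun (CadlagPath T X) fun _ => Icc (0 : ℝ) T → X :=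
  ⟨CadlagPath.toFun⟩

/-- The image `f ∘ x` of a càdlàg path under a continuous map. -/
def CadlagPath.map {X Y : Type*} [TopologicalSpace X] [TopologicalSpace Y] (f : X → Y)
    (hf : Continuous f) (x : CadlagPath T X) : CadlagPath T Y where
  toFun t := f (x t)
  rightCont t := hf.continuousAt.comp_continuousWithinAt (x.rightCont t)
  leftLimits t := by
    obtain ⟨l, hl⟩ := x.leftLimits t
    exact ⟨f l, (hf.tendsto l).comp hl⟩

variable {X : Type*} [AddCommGroup X] [Module ℝ X] [TopologicalSpace X]

/-- The order `h₁ ≤ h₂` on the interval `[f, g] = {(1 - a) • f + a • g : 0 ≤ a ≤ 1}`. -/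
def IntervalLE (f g h₁ h₂ : X) : Prop :=
  ∃ a₁ ∈ Icc (0 : ℝ) 1, ∃ a₂ ∈ Icc (0 : ℝ) 1, a₁ ≤ a₂ ∧
    h₁ = (1 - a₁) • f + a₁ • g ∧ h₂ = (1 - a₂) • f + a₂ • g

/-- The graph `γₓ` of a càdlàg path, in which the jumps are filled in by intervals
`[x(t-), x(t)]`. The left limit `x(t-)` is `Function.leftLim x t`, so that `x(0-) = x(0)`. -/
def CadlagPath.graph (x : CadlagPath T X) : Set (X × Icc (0 : ℝ) T) :=
  {w | ∃ a ∈ Icc (0 : ℝ) 1, w.1 = (1 - a) • Function.leftLim x w.2 + a • x w.2}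

/-- The order on the graph of a càdlàg path. -/
def CadlagPath.GraphLE (x : CadlagPath T X) (w₁ w₂ : X × Icc (0 : ℝ) T) : Prop :=
  w₁.2 < w₂.2 ∨
    (w₁.2 = w₂.2 ∧ IntervalLE (Function.leftLim x w₁.2) (x w₁.2) w₁.1 w₂.1)

/-- The set `Λₓ` of parametric representations of the graph of `x`: continuous non-decreasing
surjections from `[0,1]` onto the graph. -/
def CadlagPath.paramReps (x : CadlagPath T X) : Set (Icc (0 : ℝ) 1 → X × Icc (0 : ℝ) T) :=
  {l | Continuous l ∧ range l = x.graph ∧ ∀ s s', s ≤ s' → x.GraphLE (l s) (l s')}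

/-- The distance `sup_s max (q (z₁ s - z₂ s)) |t₁ s - t₂ s|` between two parametric
representations, measured by a (semi)norm `q` on `X`. -/
def paramDist (q : X → ℝ) (l₁ l₂ : Icc (0 : ℝ) 1 → X × Icc (0 : ℝ) T) : ℝ :=
  ⨆ s, max (q ((l₁ s).1 - (l₂ s).1)) |((l₁ s).2 : ℝ) - ((l₂ s).2 : ℝ)|

/-- The M1 pseudometric on `D_X` associated with a (semi)norm `q` on `X`. -/
def m1Dist (q : X → ℝ) (x y : CadlagPath T X) : ℝ :=
  sInf {r | ∃ l₁ ∈ x.paramReps, ∃ l₂ ∈ y.paramReps, r = paramDist q l₁ l₂}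

/-- The M1 topology on `D_X`, for `X` with topology generated by the seminorms `q i`: the topology
generated by the balls of all the M1 pseudometrics. -/
abbrev m1Topology {ι : Type*} (q : ι → X → ℝ) : TopologicalSpace (CadlagPath T X) :=
  TopologicalSpace.generateFrom
    {U | ∃ (i : ι) (x₀ : CadlagPath T X) (ε : ℝ), 0 < ε ∧ U = {x | m1Dist (q i) x x₀ < ε}}

end Skorokhod

/-! ### The three path spaces `(D_{E'}, M1)`, `(D_{E₋ₙ}, M1)` and `(D_ℝ, M1)` -/

/-- The M1 topology on `D_X` for a normed space `X`, in particular on `D_ℝ` and `D_{E₋ₙ}`. -/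
abbrev m1TopologyNormed (T : ℝ) (X : Type*) [SeminormedAddCommGroup X] [NormedSpace ℝ X] :
    TopologicalSpace (CadlagPath T X) :=
  m1Topology fun (_ : Unit) (z : X) => ‖z‖

section PathSpaces

variable {E : Type*} [AddCommGroup E] [Module ℝ E]

/-- The seminorm `p_B f = sup_{φ ∈ B} |f φ|` on `E'`. -/
def dualSeminorm [TopologicalSpace E] (B : Set E) (f : E →L[ℝ] ℝ) : ℝ :=
  sSup ((fun φ => |f φ|) '' B)

/-- The M1 topology on `D_{E'}`, generated by the M1 pseudometrics of the seminorms `p_B` for all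
bounded subsets `B` of `E`. -/
abbrev m1TopologyDual (T : ℝ) (E : Type*) [AddCommGroup E] [Module ℝ E] [TopologicalSpace E] :
    TopologicalSpace (CadlagPath T (E →L[ℝ] ℝ)) :=
  m1Topology fun B : {B : Set E // Bornology.IsVonNBounded ℝ B} => dualSeminorm B.1

variable [UniformSpace E] [IsUniformAddGroup E] {p : ℕ → Seminorm ℝ E} {T : ℝ}

/-- The canonical projection `π^φ : D_{E'} → D_ℝ`, `x ↦ (t ↦ x_t(φ))`. -/
def IsCountablyHilbertianNuclear.proj (hE : IsCountablyHilbertianNuclear p) (φ : E)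
    (x : CadlagPath T (E →L[ℝ] ℝ)) : CadlagPath T ℝ :=
  haveI := hE.withSeminorms.continuousSMul
  x.map (fun f : E →L[ℝ] ℝ => f φ) (continuous_eval_const φ)

/-- The canonical inclusion `D_{E₋ₙ} ⊆ D_{E'}`. -/
def IsCountablyHilbertianNuclear.pathInclusion (hE : IsCountablyHilbertianNuclear p) (n : ℕ)
    (x : CadlagPath T (NegHilbert p n)) : CadlagPath T (E →L[ℝ] ℝ) :=
  x.map (hE.dualInclusion n) (hE.dualInclusion n).continuous

end PathSpaces

/-- Compactness of a set with respect to a given topology. -/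
def IsCompactIn {D : Type*} (τ : TopologicalSpace D) (A : Set D) : Prop :=
  @IsCompact D τ A

/-- Relative compactness of a set with respect to a given topology: its closure is compact. -/
def IsRelCompactIn {D : Type*} (τ : TopologicalSpace D) (A : Set D) : Prop :=
  @IsCompact D τ (@closure D τ A)

end

set_option linter.unusedSectionVars false


/-! ### Parametric representations -/

section ParamReps

variable {T : ℝ} {X : Type*} [AddCommGroup X] [Module ℝ X]

/-! The implications from level `n` to the strong dual, and from there to the real projections, are
continuity statements. A continuous linear map carries filled graphs and their parametric
representations to those of the image path, so it is Lipschitz for suitable M1 pseudometrics. The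
path spaces in `E'` and `ℝ` are Hausdorff, so images of relatively compact sets are relatively
compact.

The content is the passage from the projections to a single level. Relatively compact projections
are bounded, so by Banach-Steinhaus on the Fréchet space `E` all values of all paths in `A` satisfy
`|x t φ| ≤ C * p n φ` with common `n` and `C`. The Hilbert-Schmidt property makes the unit ball of
some `p m` totally bounded for `p n`. Hence on the functionals bounded by `C * p n`, pointwise
convergence is norm convergence in `E₋ₘ`, and these functionals form a compact set. The paths are
therefore càdlàg in `E₋ₘ`, with values in a fixed compact set (`isCompact_levelBall`,
`mem_range_pathInclusion`).

It remains to control oscillations. A relatively compact set of real paths has a uniform one-sided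
modulus: an intermediate value exceeds the larger outer value by at most `ε`
(`IsRelCompactIn.exists_upperOsc`). A finite net extends this from finitely many test points to the
whole unit ball of `p m`, and Hahn-Banach turns the family of scalar bounds into norm distance from
a segment (`exists_mem_segment_norm_sub_le`). The criterion `isRelCompactIn_m1TopologyNormed` then
applies. Its total boundedness part matches paths close on a fine grid cell by cell. Its
completeness part aligns arcs by order isomorphisms and shows that their uniform limit is again a
parametric representation.

Throughout, arcs make the M1 distance tractable. Every parametric representation is an arc composed
with a monotone surjection, and such surjections are uniform limits of order isomorphisms, which
compose and invert. -/

theorem IntervalLE.antisymm {f g h₁ h₂ : X} (h : IntervalLE f g h₁ h₂)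
    (h' : IntervalLE f g h₂ h₁) : h₁ = h₂ := by
  obtain ⟨a₁, -, a₂, -, ha, e₁, e₂⟩ := h
  obtain ⟨b₁, -, b₂, -, hb, e₃, e₄⟩ := h'
  by_cases hd : f = g
  · subst hd
    rw [e₁, e₂, ← add_smul, ← add_smul]
    simp
  · have key : ∀ a b : ℝ, (1 - a) • f + a • g = (1 - b) • f + b • g → a = b := by
      intro a b hab
      have : (b - a) • (f - g) = 0 := by
        have h0 := sub_eq_zero.mpr hab
        rw [← h0]
        module
      rcases smul_eq_zero.mp this with h | h
      · linarith
      · exact absurd (sub_eq_zero.mp h) hd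
    have h1 := key a₁ b₂ (e₁.symm.trans e₄)
    have h2 := key a₂ b₁ (e₂.symm.trans e₃)
    have h3 : a₁ = a₂ := by linarith
    rw [e₁, e₂, h3]

/-- The distance between two points of `X × [0, T]` that is used in the definition of the M1
pseudometric. -/
def graphDist (q : X → ℝ) (w v : X × Icc (0 : ℝ) T) : ℝ :=
  max (q (w.1 - v.1)) |(w.2 : ℝ) - (v.2 : ℝ)|

theorem graphDist_self (q : Seminorm ℝ X) (w : X × Icc (0 : ℝ) T) : graphDist q w w = 0 := by
  simp [graphDist]

theorem graphDist_nonneg (q : X → ℝ) (w v : X × Icc (0 : ℝ) T) : 0 ≤ graphDist q w v :=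
  (abs_nonneg _).trans (le_max_right _ _)

theorem graphDist_comm (q : Seminorm ℝ X) (w v : X × Icc (0 : ℝ) T) :
    graphDist q w v = graphDist q v w := by
  simp only [graphDist, map_sub_rev q w.1, abs_sub_comm (w.2 : ℝ)]

theorem graphDist_triangle (q : Seminorm ℝ X) (w v u : X × Icc (0 : ℝ) T) :
    graphDist q w u ≤ graphDist q w v + graphDist q v u := by
  refine max_le ?_ ?_
  · calc q (w.1 - u.1) = q ((w.1 - v.1) + (v.1 - u.1)) := by congr 1; abel
      _ ≤ q (w.1 - v.1) + q (v.1 - u.1) := map_add_le_add q _ _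
      _ ≤ _ := add_le_add (le_max_left _ _) (le_max_left _ _)
  · exact (abs_sub_le _ (v.2 : ℝ) _).trans (add_le_add (le_max_right _ _) (le_max_right _ _))

variable [TopologicalSpace X]

theorem CadlagPath.ext {x y : CadlagPath T X} (h : ∀ t, x t = y t) : x = y := by
  cases x; cases y
  congr
  exact funext h

theorem CadlagPath.tendsto_leftLim (x : CadlagPath T X) (t : Icc (0 : ℝ) T) :
    Tendsto x (𝓝[<] t) (𝓝 (Function.leftLim x t)) :=
  tendsto_leftLim_of_tendsto (x.leftLimits t)

theorem CadlagPath.leftLim_zero (x : CadlagPath T X) {t : Icc (0 : ℝ) T} (ht : (t : ℝ) = 0) :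
    Function.leftLim x t = x t :=
  leftLim_eq_of_isBot fun s => by
    rw [← Subtype.coe_le_coe, ht]; exact s.2.1

theorem CadlagPath.GraphLE.antisymm {x : CadlagPath T X} {w v : X × Icc (0 : ℝ) T}
    (h : x.GraphLE w v) (h' : x.GraphLE v w) : w = v := by
  rcases h with h | ⟨h, hi⟩
  · rcases h' with h' | ⟨h', -⟩
    · exact absurd h (not_lt.mpr h'.le)
    · exact absurd h (by rw [h']; exact lt_irrefl _)
  · rcases h' with h' | ⟨-, hi'⟩
    · exact absurd h' (by rw [h]; exact lt_irrefl _)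
    · rw [← h] at hi'
      exact Prod.ext (hi.antisymm hi') h

theorem CadlagPath.comp_mem_paramReps {x : CadlagPath T X}
    {l : Icc (0 : ℝ) 1 → X × Icc (0 : ℝ) T} (hl : l ∈ x.paramReps)
    {f : Icc (0 : ℝ) 1 → Icc (0 : ℝ) 1} (hc : Continuous f) (hm : Monotone f)
    (hs : Function.Surjective f) : l ∘ f ∈ x.paramReps :=
  ⟨hl.1.comp hc, by rw [hs.range_comp]; exact hl.2.1, fun _ _ h => hl.2.2 _ _ (hm h)⟩

theorem CadlagPath.monotone_time {x : CadlagPath T X}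
    {l : Icc (0 : ℝ) 1 → X × Icc (0 : ℝ) T} (hl : l ∈ x.paramReps) :
    Monotone fun s => (l s).2 := fun s s' h => by
  rcases hl.2.2 s s' h with h | ⟨h, -⟩
  · exact h.le
  · exact h.le

theorem CadlagPath.mem_graph (x : CadlagPath T X) (t : Icc (0 : ℝ) T) : (x t, t) ∈ x.graph :=
  ⟨1, by simp, by simp⟩

/-- An arc of a càdlàg path is an injective parametric representation. -/
def CadlagPath.IsArc (x : CadlagPath T X) (l : Icc (0 : ℝ) 1 → X × Icc (0 : ℝ) T) : Prop :=
  l ∈ x.paramReps ∧ Function.Injective l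

theorem CadlagPath.IsArc.le {x : CadlagPath T X} {l : Icc (0 : ℝ) 1 → X × Icc (0 : ℝ) T}
    (hl : x.IsArc l) {a b : Icc (0 : ℝ) 1} (h : x.GraphLE (l a) (l b)) : a ≤ b := by
  by_contra hab
  have h' := hl.1.2.2 b a (not_le.mp hab).le
  exact hab (hl.2 (h.antisymm h')).le

/-- Every parametric representation factors through an arc. -/
theorem CadlagPath.IsArc.factor [T2Space X] {x : CadlagPath T X}
    {l l' : Icc (0 : ℝ) 1 → X × Icc (0 : ℝ) T}
    (hl : x.IsArc l) (hl' : l' ∈ x.paramReps) :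
    ∃ f : Icc (0 : ℝ) 1 → Icc (0 : ℝ) 1, Continuous f ∧ Monotone f ∧ Function.Surjective f ∧
      l' = l ∘ f := by
  have hmem : ∀ s, ∃ u, l u = l' s := fun s => by
    have : l' s ∈ range l := by rw [hl.1.2.1, ← hl'.2.1]; exact mem_range_self s
    exact this
  choose f hf using hmem
  refine ⟨f, ?_, ?_, ?_, funext fun s => (hf s).symm⟩
  · have hemb := (hl.1.1.isClosedEmbedding hl.2).isEmbedding
    rw [hemb.continuous_iff]
    have : l ∘ f = l' := funext hf
    rw [this]; exact hl'.1
  · intro s s' h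
    apply hl.le
    rw [hf, hf]
    exact hl'.2.2 s s' h
  · intro u
    have : l u ∈ range l' := by rw [hl'.2.1, ← hl.1.2.1]; exact mem_range_self u
    obtain ⟨s, hs⟩ := this
    exact ⟨s, hl.2 (by rw [hf, hs])⟩

theorem CadlagPath.IsArc.comp {x : CadlagPath T X} {l : Icc (0 : ℝ) 1 → X × Icc (0 : ℝ) T}
    (hl : x.IsArc l) (ψ : Icc (0 : ℝ) 1 ≃o Icc (0 : ℝ) 1) : x.IsArc (l ∘ ψ) :=
  ⟨CadlagPath.comp_mem_paramReps hl.1 ψ.toHomeomorph.continuous ψ.monotone ψ.surjective,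
    hl.2.comp ψ.injective⟩

end ParamReps

/-! ### Monotone surjections of the unit interval. -/

theorem surjective_of_continuous_zero_one {f : Icc (0 : ℝ) 1 → Icc (0 : ℝ) 1}
    (hc : Continuous f) (h0 : f 0 = 0) (h1 : f 1 = 1) : Function.Surjective f := fun u =>
  mem_range_of_exists_le_of_exists_ge hc ⟨0, by rw [h0]; exact u.2.1⟩ ⟨1, by rw [h1]; exact u.2.2⟩

theorem monotone_surjective_zero {f : Icc (0 : ℝ) 1 → Icc (0 : ℝ) 1}
    (hm : Monotone f) (hs : Function.Surjective f) : f 0 = 0 := by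
  obtain ⟨u, hu⟩ := hs 0
  exact le_antisymm ((hm (show (0 : Icc (0 : ℝ) 1) ≤ u from u.2.1)).trans hu.le) (f 0).2.1

theorem monotone_surjective_one {f : Icc (0 : ℝ) 1 → Icc (0 : ℝ) 1}
    (hm : Monotone f) (hs : Function.Surjective f) : f 1 = 1 := by
  obtain ⟨u, hu⟩ := hs 1
  exact le_antisymm (f 1).2.2 (hu.ge.trans (hm (show u ≤ (1 : Icc (0 : ℝ) 1) from u.2.2)))

/-- A continuous monotone surjection of the unit interval is a uniform limit of order
isomorphisms. -/
theorem exists_orderIso_near {f : Icc (0 : ℝ) 1 → Icc (0 : ℝ) 1} (hc : Continuous f)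
    (hm : Monotone f) (hs : Function.Surjective f) {ε : ℝ} (hε : 0 < ε) :
    ∃ ψ : Icc (0 : ℝ) 1 ≃o Icc (0 : ℝ) 1, ∀ s, dist (ψ s) (f s) < ε := by
  set e : ℝ := min (ε / 2) (1 / 2) with he
  have he0 : 0 < e := lt_min (by linarith) (by norm_num)
  have he1 : e ≤ 1 / 2 := min_le_right _ _
  have heε : e ≤ ε / 2 := min_le_left _ _
  -- Mixing in a small multiple of the identity makes `f` strictly increasing, keeps the end points
  -- fixed, and moves values by at most `e`.
  let g : Icc (0 : ℝ) 1 → Icc (0 : ℝ) 1 := fun s =>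
    ⟨(1 - e) * f s + e * s, by
      have h1 := (f s).2.1; have h2 := s.2.1
      have := mul_nonneg (by linarith : 0 ≤ 1 - e) h1
      have := mul_nonneg he0.le h2
      linarith, by
      have h1 := (f s).2.2; have h2 := s.2.2
      nlinarith⟩
  have hgm : StrictMono g := fun s s' h => by
    have h1 : (f s : ℝ) ≤ f s' := hm h.le
    have h2 : (s : ℝ) < s' := h
    change (1 - e) * (f s : ℝ) + e * s < (1 - e) * (f s' : ℝ) + e * s'
    have := mul_le_mul_of_nonneg_left h1 (by linarith : 0 ≤ 1 - e)
    have := mul_lt_mul_of_pos_left h2 he0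
    linarith
  have hgc : Continuous g := by
    refine Continuous.subtype_mk ?_ _
    fun_prop
  have hgs : Function.Surjective g := surjective_of_continuous_zero_one hgc
    (Subtype.ext (by simp [g, monotone_surjective_zero hm hs]))
    (Subtype.ext (by simp [g, monotone_surjective_one hm hs]))
  refine ⟨hgm.orderIsoOfSurjective g hgs, fun s => ?_⟩
  change |((1 - e) * (f s : ℝ) + e * s) - f s| < ε
  have h1 := (f s).2; have h2 := s.2
  have : ((1 - e) * (f s : ℝ) + e * s) - f s = e * (s - f s) := by ring
  rw [this, abs_mul, abs_of_pos he0]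
  have : |(s : ℝ) - f s| ≤ 1 := abs_le.mpr ⟨by linarith [h1.1, h1.2, h2.1, h2.2],
    by linarith [h1.1, h1.2, h2.1, h2.2]⟩
  nlinarith

/-! ### The M1 pseudometrics -/

section M1Dist

variable {T : ℝ} {X : Type*} [AddCommGroup X] [Module ℝ X] [TopologicalSpace X]
  [IsTopologicalAddGroup X] {q : Seminorm ℝ X}

theorem continuous_graphDist (hq : Continuous q) :
    Continuous fun a : (X × Icc (0 : ℝ) T) × (X × Icc (0 : ℝ) T) => graphDist q a.1 a.2 := by
  unfold graphDist
  have h1 : Continuous fun a : (X × Icc (0 : ℝ) T) × (X × Icc (0 : ℝ) T) => a.1.1 - a.2.1 := by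
    fun_prop
  exact (hq.comp h1).max (by fun_prop)

theorem graphDist_uniform (hq : Continuous q) {l : Icc (0 : ℝ) 1 → X × Icc (0 : ℝ) T}
    (hl : Continuous l) {ε : ℝ} (hε : 0 < ε) :
    ∃ η > 0, ∀ s s', dist s s' < η → graphDist q (l s) (l s') < ε := by
  have hF : Continuous fun a : Icc (0 : ℝ) 1 × Icc (0 : ℝ) 1 => graphDist q (l a.1) (l a.2) :=
    (continuous_graphDist hq).comp (by fun_prop :
      Continuous fun a : Icc (0 : ℝ) 1 × Icc (0 : ℝ) 1 => (l a.1, l a.2))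
  obtain ⟨η, hη, h⟩ := Metric.uniformContinuous_iff.mp
    (CompactSpace.uniformContinuous_of_continuous hF) ε hε
  refine ⟨η, hη, fun s s' hs => ?_⟩
  have := @h (s, s') (s', s') (by rw [Prod.dist_eq]; simpa [hη] using hs)
  rw [Real.dist_eq, graphDist_self, sub_zero] at this
  exact (le_abs_self _).trans_lt this

theorem graphDist_le_paramDist (hq : Continuous q) {l l' : Icc (0 : ℝ) 1 → X × Icc (0 : ℝ) T}
    (hl : Continuous l) (hl' : Continuous l') (s : Icc (0 : ℝ) 1) :
    graphDist q (l s) (l' s) ≤ paramDist q l l' := by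
  have hF : Continuous fun s => graphDist q (l s) (l' s) :=
    (continuous_graphDist hq).comp (hl.prodMk hl')
  exact le_ciSup (f := fun s => graphDist q (l s) (l' s)) (isCompact_range hF).bddAbove s

theorem paramDist_le {q : X → ℝ} {l l' : Icc (0 : ℝ) 1 → X × Icc (0 : ℝ) T} {r : ℝ}
    (h : ∀ s, graphDist q (l s) (l' s) ≤ r) : paramDist q l l' ≤ r :=
  ciSup_le h

theorem paramDist_nonneg (q : X → ℝ) (l l' : Icc (0 : ℝ) 1 → X × Icc (0 : ℝ) T) :
    0 ≤ paramDist q l l' :=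
  Real.iSup_nonneg fun _ => graphDist_nonneg q _ _

theorem paramDist_comm (q : Seminorm ℝ X) (l l' : Icc (0 : ℝ) 1 → X × Icc (0 : ℝ) T) :
    paramDist q l l' = paramDist q l' l :=
  iSup_congr fun s => graphDist_comm q (l s) (l' s)

theorem m1Dist_nonneg (q : X → ℝ) (x y : CadlagPath T X) : 0 ≤ m1Dist q x y :=
  Real.sInf_nonneg (by rintro r ⟨l, -, l', -, rfl⟩; exact paramDist_nonneg q l l')

theorem m1Dist_comm (q : Seminorm ℝ X) (x y : CadlagPath T X) :
    m1Dist q x y = m1Dist q y x := by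
  unfold m1Dist
  congr 1
  ext r
  constructor <;> rintro ⟨l, hl, l', hl', rfl⟩ <;> exact ⟨l', hl', l, hl, paramDist_comm q _ _⟩

theorem m1Dist_le_paramDist (q : X → ℝ) {x y : CadlagPath T X}
    {l l' : Icc (0 : ℝ) 1 → X × Icc (0 : ℝ) T} (hl : l ∈ x.paramReps) (hl' : l' ∈ y.paramReps) :
    m1Dist q x y ≤ paramDist q l l' :=
  csInf_le ⟨0, by rintro r ⟨l, -, l', -, rfl⟩; exact paramDist_nonneg q l l'⟩
    ⟨l, hl, l', hl', rfl⟩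

theorem m1Dist_le (q : X → ℝ) {x y : CadlagPath T X}
    {l l' : Icc (0 : ℝ) 1 → X × Icc (0 : ℝ) T} (hl : l ∈ x.paramReps) (hl' : l' ∈ y.paramReps)
    {r : ℝ} (h : ∀ s, graphDist q (l s) (l' s) ≤ r) : m1Dist q x y ≤ r :=
  (m1Dist_le_paramDist q hl hl').trans (paramDist_le h)

theorem m1Dist_self (q : Seminorm ℝ X) {x : CadlagPath T X} (hx : x.paramReps.Nonempty) :
    m1Dist q x x = 0 := by
  obtain ⟨l, hl⟩ := hx
  exact le_antisymm (m1Dist_le q hl hl fun s => (graphDist_self q _).le) (m1Dist_nonneg _ _ _)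

theorem exists_paramReps_of_m1Dist_lt (hq : Continuous q) {x y : CadlagPath T X}
    (hx : x.paramReps.Nonempty) (hy : y.paramReps.Nonempty) {r : ℝ} (h : m1Dist q x y < r) :
    ∃ l ∈ x.paramReps, ∃ l' ∈ y.paramReps, ∃ r' < r, ∀ s, graphDist q (l s) (l' s) ≤ r' := by
  obtain ⟨lx, hlx⟩ := hx
  obtain ⟨ly, hly⟩ := hy
  obtain ⟨_, ⟨l, hl, l', hl', rfl⟩, hr⟩ := exists_lt_of_csInf_lt
    (show {r | ∃ l₁ ∈ x.paramReps, ∃ l₂ ∈ y.paramReps, r = paramDist q l₁ l₂}.Nonempty from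
      ⟨_, lx, hlx, ly, hly, rfl⟩) h
  exact ⟨l, hl, l', hl', _, hr, graphDist_le_paramDist hq hl.1 hl'.1⟩

/-- The M1 pseudometric can be computed from order isomorphisms between given arcs. -/
theorem exists_orderIso_of_m1Dist_lt [T2Space X] (hq : Continuous q) {x y : CadlagPath T X}
    {lx ly : Icc (0 : ℝ) 1 → X × Icc (0 : ℝ) T} (hx : x.IsArc lx) (hy : y.IsArc ly) {r : ℝ}
    (h : m1Dist q x y < r) :
    ∃ ψ : Icc (0 : ℝ) 1 ≃o Icc (0 : ℝ) 1, ∀ s, graphDist q (lx s) (ly (ψ s)) < r := by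
  obtain ⟨l, hl, l', hl', r', hr, hd⟩ := exists_paramReps_of_m1Dist_lt hq ⟨lx, hx.1⟩ ⟨ly, hy.1⟩ h
  obtain ⟨f, fc, fm, fs, rfl⟩ := hx.factor hl
  obtain ⟨g, gc, gm, gs, rfl⟩ := hy.factor hl'
  -- The strict gap `r - r'` pays for replacing both monotone surjections by order isomorphisms,
  -- half of it for each.
  have hε : 0 < (r - r') / 2 := by linarith
  obtain ⟨η, hη, hx'⟩ := graphDist_uniform hq hx.1.1 hε
  obtain ⟨η', hη', hy'⟩ := graphDist_uniform hq hy.1.1 hε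
  obtain ⟨φ, hφ⟩ := exists_orderIso_near fc fm fs hη
  obtain ⟨χ, hχ⟩ := exists_orderIso_near gc gm gs hη'
  refine ⟨φ.symm.trans χ, fun s => ?_⟩
  obtain ⟨u, rfl⟩ := φ.surjective s
  have e : (φ.symm.trans χ) (φ u) = χ u := by simp
  rw [e]
  have h1 := hx' _ _ (hφ u)
  have h2 := hy' (g u) (χ u) (by rw [dist_comm]; exact hχ u)
  have h3 := hd u
  have h4 := graphDist_triangle q (lx (φ u)) (lx (f u)) (ly (χ u))
  have h5 := graphDist_triangle q (lx (f u)) (ly (g u)) (ly (χ u))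
  simp only [Function.comp] at h3
  linarith

/-- Near-optimal representations of `y` for the two distances need not agree. Measuring both against
one fixed arc of `y` turns the matchings into order isomorphisms, which compose. -/
theorem m1Dist_triangle [T2Space X] (hq : Continuous q) {x y z : CadlagPath T X}
    (hx : ∃ l, x.IsArc l) (hy : ∃ l, y.IsArc l) (hz : ∃ l, z.IsArc l) :
    m1Dist q x z ≤ m1Dist q x y + m1Dist q y z := by
  obtain ⟨lx, hx⟩ := hx
  obtain ⟨ly, hy⟩ := hy
  obtain ⟨lz, hz⟩ := hz
  refine le_of_forall_pos_le_add fun ε hε => ?_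
  obtain ⟨ψ, hψ⟩ := exists_orderIso_of_m1Dist_lt hq hx hy
    (show m1Dist q x y < m1Dist q x y + ε / 2 by linarith)
  obtain ⟨χ, hχ⟩ := exists_orderIso_of_m1Dist_lt hq hy hz
    (show m1Dist q y z < m1Dist q y z + ε / 2 by linarith)
  refine m1Dist_le q hx.1 (hz.comp (ψ.trans χ)).1 fun s => ?_
  have h1 := hψ s
  have h2 := hχ (ψ s)
  have h3 := graphDist_triangle q (lx s) (ly (ψ s)) (lz (χ (ψ s)))
  change graphDist q (lx s) (lz (χ (ψ s))) ≤ _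
  linarith

end M1Dist

/-! ### Linear images of càdlàg paths -/

section Map

variable {T : ℝ} {X Y : Type*} [AddCommGroup X] [Module ℝ X] [TopologicalSpace X]
  [AddCommGroup Y] [Module ℝ Y] [TopologicalSpace Y] {f : X → Y}

theorem CadlagPath.leftLim_map [T2Space Y] (hf : Continuous f) (x : CadlagPath T X)
    (t : Icc (0 : ℝ) T) : Function.leftLim (x.map f hf) t = f (Function.leftLim x t) := by
  rcases eq_or_neBot (𝓝[<] t) with h | h
  · rw [leftLim_eq_of_eq_bot _ h, leftLim_eq_of_eq_bot _ h]; rfl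
  · exact leftLim_eq_of_tendsto ((hf.tendsto _).comp (x.tendsto_leftLim t))

theorem CadlagPath.map_mem_paramReps [T2Space Y] (hf : Continuous f) (hl : IsLinearMap ℝ f)
    {x : CadlagPath T X} {l : Icc (0 : ℝ) 1 → X × Icc (0 : ℝ) T} (h : l ∈ x.paramReps) :
    (fun s => (f (l s).1, (l s).2)) ∈ (x.map f hf).paramReps := by
  have hcomb : ∀ (a : ℝ) (u v : X), f ((1 - a) • u + a • v) = (1 - a) • f u + a • f v := by
    intro a u v
    rw [hl.map_add, hl.map_smul, hl.map_smul]
  refine ⟨(hf.comp (continuous_fst.comp h.1)).prodMk (continuous_snd.comp h.1), ?_, ?_⟩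
  · ext ⟨z, t⟩
    constructor
    · rintro ⟨s, hs⟩
      have hm : l s ∈ x.graph := by rw [← h.2.1]; exact mem_range_self s
      obtain ⟨a, ha, he⟩ := hm
      simp only [Prod.mk.injEq] at hs
      refine ⟨a, ha, ?_⟩
      rw [leftLim_map, ← hs.1, ← hs.2, he]
      exact hcomb _ _ _
    · rintro ⟨a, ha, he⟩
      rw [leftLim_map] at he
      have hm : ((1 - a) • Function.leftLim x t + a • x t, t) ∈ x.graph := ⟨a, ha, rfl⟩
      rw [← h.2.1] at hm
      obtain ⟨s, hs⟩ := hm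
      refine ⟨s, ?_⟩
      simp only [hs]
      exact Prod.ext ((hcomb _ _ _).trans he.symm) rfl
  · intro s s' hss
    rcases h.2.2 s s' hss with h1 | ⟨h1, a, ha, b, hb, hab, e1, e2⟩
    · exact Or.inl h1
    · refine Or.inr ⟨h1, a, ha, b, hb, hab, ?_, ?_⟩
      · rw [leftLim_map]; simp only [e1]; exact hcomb _ _ _
      · rw [leftLim_map]; simp only [e2]; exact hcomb _ _ _

theorem CadlagPath.IsArc.map [T2Space Y] (hf : Continuous f) (hl : IsLinearMap ℝ f)
    (hi : Function.Injective f)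
    {x : CadlagPath T X} {l : Icc (0 : ℝ) 1 → X × Icc (0 : ℝ) T} (h : x.IsArc l) :
    (x.map f hf).IsArc fun s => (f (l s).1, (l s).2) :=
  ⟨map_mem_paramReps hf hl h.1, fun s s' hs => by
    simp only [Prod.mk.injEq] at hs
    exact h.2 (Prod.ext (hi hs.1) hs.2)⟩

/-- Representations are mapped pointwise. The time component is not scaled by `f`, which is why `C`
must be at least `1`. -/
theorem m1Dist_map_le [T2Space Y] [IsTopologicalAddGroup X] [IsTopologicalAddGroup Y]
    {q : Seminorm ℝ X} (hq : Continuous q) {q' : Y → ℝ} {C : ℝ} (hC : 1 ≤ C)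
    (hf : Continuous f) (hl : IsLinearMap ℝ f) (hb : ∀ z, q' (f z) ≤ C * q z)
    {x y : CadlagPath T X} (hx : x.paramReps.Nonempty) (hy : y.paramReps.Nonempty) :
    m1Dist q' (x.map f hf) (y.map f hf) ≤ C * m1Dist q x y := by
  refine le_of_forall_gt_imp_ge_of_dense fun r hr => ?_
  have hC0 : 0 < C := by linarith
  have : m1Dist q x y < r / C := by rwa [lt_div_iff₀ hC0, mul_comm]
  obtain ⟨l, h1, l', h1', r', hr', hd⟩ := exists_paramReps_of_m1Dist_lt hq hx hy this
  refine m1Dist_le q' (CadlagPath.map_mem_paramReps hf hl h1)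
    (CadlagPath.map_mem_paramReps hf hl h1') fun s => ?_
  have hd' := (hd s).trans hr'.le
  have h3 : C * graphDist q (l s) (l' s) ≤ r := by
    rwa [le_div_iff₀ hC0, mul_comm] at hd'
  refine le_trans (max_le ?_ ?_) h3
  · simp only [← hl.map_sub]
    exact (hb _).trans (mul_le_mul_of_nonneg_left (le_max_left _ _) hC0.le)
  · calc |((l s).2 : ℝ) - (l' s).2| ≤ graphDist q (l s) (l' s) := le_max_right _ _
      _ ≤ C * _ := le_mul_of_one_le_left (graphDist_nonneg _ _ _) hC

end Map


/-! ### Existence of arcs of càdlàg paths in normed spaces -/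

/-- A left limit is a cluster point of nearby values, so it stays in every closed neighbourhood that
contains those values. -/
theorem tendsto_leftLim_of_tendsto_nhdsWithin {α β : Type*} [LinearOrder α] [TopologicalSpace α]
    [OrderTopology α] [TopologicalSpace β] [RegularSpace β] {f : α → β} {U : Set α} (hU : IsOpen U)
    {a : α} {y : β} (h : Tendsto f (𝓝[U] a) (𝓝 y)) :
    Tendsto (Function.leftLim f) (𝓝[U] a) (𝓝 y) := by
  refine (closed_nhds_basis y).tendsto_right_iff.mpr ?_
  rintro V ⟨hV, hVc⟩
  have h1 : ∀ᶠ s in 𝓝[U] a, f s ∈ V := h hV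
  have h2 := eventually_eventually_nhdsWithin.mpr h1
  filter_upwards [h2, self_mem_nhdsWithin] with s hs hsU
  rw [hU.nhdsWithin_eq hsU] at hs
  have h3 := mapClusterPt_leftLim f s
  have h4 : ∀ᶠ r in 𝓝[≤] s, f r ∈ V := hs.filter_mono nhdsWithin_le_nhds
  exact hVc.mem_of_mapClusterPt h3 h4

/-! ### A time change that opens an interval at every jump. -/

section Clock

variable {T : ℝ}

/-- Give the points of `J` summable positive weights `c`, and let `m t` be `t` plus the total weight
of the points before `t`. The clock rests at `t` during `[m t, m t + c t]`. Dominated convergence of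
the sums gives the one-sided limits. -/
theorem exists_clock {J : Set (Icc (0 : ℝ) T)} (hJ : J.Countable) :
    ∃ c m : Icc (0 : ℝ) T → ℝ, (∀ t, 0 ≤ c t) ∧ (∀ t, c t ≠ 0 ↔ t ∈ J) ∧
      (∀ t t', t < t' → m t + c t + ((t' : ℝ) - t) ≤ m t') ∧
      (∀ t : Icc (0 : ℝ) T, (t : ℝ) = 0 → m t = 0) ∧
      (∀ t, Tendsto m (𝓝[<] t) (𝓝 (m t))) ∧ ∀ t, Tendsto m (𝓝[>] t) (𝓝 (m t + c t)) := by
  classical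
  obtain ⟨ε, hε, C, hC, -⟩ := hJ.exists_pos_hasSum_le one_pos
  set c : Icc (0 : ℝ) T → ℝ := J.indicator ε with hc
  have hcs : Summable c := summable_subtype_iff_indicator.mp hC.summable
  have hc0 : ∀ t, 0 ≤ c t := fun t => indicator_nonneg (fun s _ => (hε s).le) t
  let g : Icc (0 : ℝ) T → Icc (0 : ℝ) T → ℝ := fun t => (Iio t).indicator c
  have hgs : ∀ t, Summable (g t) := fun t => hcs.indicator _
  have hgb : ∀ t s, ‖g t s‖ ≤ c s := fun t s => by
    rw [Real.norm_of_nonneg (indicator_nonneg (fun s _ => hc0 s) s)]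
    exact indicator_le_self' (fun _ _ => hc0 _) s
  have hadd : ∀ t, (∑' s, g t s) + c t = ∑' s, (Iic t).indicator c s := fun t => by
    have h1 : ∀ s, (Iic t).indicator c s = g t s + ({t} : Set (Icc (0 : ℝ) T)).indicator c s := by
      intro s
      rcases lt_trichotomy s t with h | h | h
      · simp [g, h, h.le, h.ne]
      · simp [g, h]
      · simp [g, h.not_ge, h.ne', h.not_gt]
    simp_rw [h1]
    rw [(hgs t).tsum_add (hcs.indicator _)]
    congr 1
    rw [tsum_eq_single t]
    · simp
    · intro s hs; simp [hs]
  refine ⟨c, fun t => t + ∑' s, g t s, hc0, fun t => ?_, fun t t' h => ?_, fun t ht => ?_,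
    fun t => ?_, fun t => ?_⟩
  · by_cases h : t ∈ J
    · simp [hc, h, (hε t).ne']
    · simp [hc, h]
  · have : (∑' s, g t s) + c t ≤ ∑' s, g t' s := by
      rw [hadd]
      refine Summable.tsum_le_tsum (fun s => ?_) (hcs.indicator _) (hgs _)
      exact indicator_le_indicator_of_subset (fun s hs => lt_of_le_of_lt hs h) hc0 s
    linarith
  · have : ∀ s, g t s = 0 := fun s => by
      have : ¬ s < t := fun h => by
        have h' : (s : ℝ) < t := h
        linarith [s.2.1]
      simp [g, this]
    simp [this, ht]
  · refine (continuous_subtype_val.continuousAt.mono_left nhdsWithin_le_nhds).add ?_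
    refine tendsto_tsum_of_dominated_convergence hcs (fun s => ?_)
      (Eventually.of_forall fun t s => hgb t s)
    refine tendsto_const_nhds.congr' ?_
    by_cases h : s < t
    · filter_upwards [Ioo_mem_nhdsLT h] with r hr
      simp [g, h, hr.1]
    · filter_upwards [self_mem_nhdsWithin] with r hr
      have : ¬ s < r := fun h' => h (h'.trans hr)
      simp [g, h, this]
  · have e : (t : ℝ) + (∑' s, g t s) + c t = t + ∑' s, (Iic t).indicator c s := by
      rw [← hadd]; ring
    rw [e]
    refine (continuous_subtype_val.continuousAt.mono_left nhdsWithin_le_nhds).add ?_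
    refine tendsto_tsum_of_dominated_convergence hcs (fun s => ?_)
      (Eventually.of_forall fun t s => hgb t s)
    refine tendsto_const_nhds.congr' ?_
    by_cases h : s ≤ t
    · filter_upwards [self_mem_nhdsWithin] with r hr
      have : s < r := lt_of_le_of_lt h hr
      simp [g, h, this]
    · filter_upwards [Ioo_mem_nhdsGT (not_le.mp h)] with r hr
      simp [g, h, hr.2.le]

/-- The clock intervals leave no gap: the supremum of the times with `m t ≤ u` works, by left
continuity of `m` for the first bound and by its right limit for the second. -/
theorem exists_clock_inverse (hT : 0 ≤ T) {c m : Icc (0 : ℝ) T → ℝ}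
    (h0 : ∀ t : Icc (0 : ℝ) T, (t : ℝ) = 0 → m t = 0)
    (hl : ∀ t, Tendsto m (𝓝[<] t) (𝓝 (m t)))
    (hr : ∀ t, Tendsto m (𝓝[>] t) (𝓝 (m t + c t))) {u : ℝ} (hu : 0 ≤ u)
    (hu' : u ≤ m ⟨T, hT, le_rfl⟩ + c ⟨T, hT, le_rfl⟩) :
    ∃ t, m t ≤ u ∧ u ≤ m t + c t := by
  set A := {t | m t ≤ u} with hA
  have hne : A.Nonempty := ⟨⟨0, le_rfl, hT⟩, by
    change m _ ≤ u
    rw [h0 _ rfl]; exact hu⟩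
  obtain ⟨t, -, ht⟩ := (isClosed_closure (s := A)).isCompact.exists_isLUB hne.closure
  rw [IsLUB, upperBounds_closure] at ht
  change IsLUB A t at ht
  refine ⟨t, ?_, ?_⟩
  · by_contra h
    rw [not_le] at h
    have h1 : ∀ᶠ s in 𝓝[≤] t, u < m s := by
      have h2 : ContinuousWithinAt m (Iio t) t := hl t
      have h3 : ContinuousWithinAt m (Iic t) t := continuousWithinAt_Iio_iff_Iic.mp h2
      exact h3.tendsto.eventually (lt_mem_nhds h)
    obtain ⟨s, hs, hs'⟩ := ((ht.frequently_mem hne).and_eventually h1).exists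
    exact absurd hs (not_le.mpr hs')
  · by_contra h
    rw [not_le] at h
    rcases eq_or_lt_of_le t.2.2 with h' | h'
    · have : t = ⟨T, hT, le_rfl⟩ := Subtype.ext h'
      rw [this] at h
      linarith
    · have hlt : t < ⟨T, hT, le_rfl⟩ := h'
      have : (𝓝[>] t).NeBot := nhdsGT_neBot_of_exists_gt ⟨_, hlt⟩
      obtain ⟨s, hs, hs'⟩ :=
        (((hr t).eventually (gt_mem_nhds h)).and self_mem_nhdsWithin).exists
      exact absurd (ht.1 (show s ∈ A from hs.le)) (not_le.mpr hs')

end Clock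

/-! ### Arcs of paths in a normed space. -/

section Arc

variable {T : ℝ} {X : Type*} [NormedAddCommGroup X] [NormedSpace ℝ X]

theorem CadlagPath.tendsto_leftLim_nhdsGT (x : CadlagPath T X) (t : Icc (0 : ℝ) T) :
    Tendsto (Function.leftLim x) (𝓝[>] t) (𝓝 (x t)) :=
  tendsto_leftLim_of_tendsto_nhdsWithin isOpen_Ioi
    ((x.rightCont t).tendsto.mono_left (nhdsWithin_mono _ Ioi_subset_Ici_self))

theorem CadlagPath.tendsto_nhdsGT (x : CadlagPath T X) (t : Icc (0 : ℝ) T) :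
    Tendsto x (𝓝[>] t) (𝓝 (x t)) :=
  (x.rightCont t).tendsto.mono_left (nhdsWithin_mono _ Ioi_subset_Ici_self)

theorem CadlagPath.tendsto_leftLim_nhdsLT (x : CadlagPath T X) (t : Icc (0 : ℝ) T) :
    Tendsto (Function.leftLim x) (𝓝[<] t) (𝓝 (Function.leftLim x t)) :=
  tendsto_leftLim_of_tendsto_nhdsWithin isOpen_Iio (x.tendsto_leftLim t)

theorem tendsto_convexComb {ι : Type*} {F : Filter ι} {f g : ι → X} {a : ι → ℝ} {y : X}
    (ha : ∀ i, a i ∈ Icc (0 : ℝ) 1) (hf : Tendsto f F (𝓝 y)) (hg : Tendsto g F (𝓝 y)) :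
    Tendsto (fun i => (1 - a i) • f i + a i • g i) F (𝓝 y) := by
  rw [tendsto_iff_norm_sub_tendsto_zero] at *
  refine squeeze_zero (fun _ => norm_nonneg _) (fun i => ?_) (by simpa using hf.add hg)
  have e : (1 - a i) • f i + a i • g i - y = (1 - a i) • (f i - y) + a i • (g i - y) := by module
  rw [e]
  refine (norm_add_le _ _).trans (add_le_add ?_ ?_)
  · rw [norm_smul, Real.norm_of_nonneg (by linarith [(ha i).2])]
    exact mul_le_of_le_one_left (norm_nonneg _) (by linarith [(ha i).1])
  · rw [norm_smul, Real.norm_of_nonneg (ha i).1]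
    exact mul_le_of_le_one_left (norm_nonneg _) (ha i).2

/-- Jumps larger than a fixed size cannot accumulate: on either side of a time, the path and its
left limits converge to the same point. Compactness leaves finitely many of each size. -/
theorem CadlagPath.countable_jumps (x : CadlagPath T X) :
    {t | Function.leftLim x t ≠ x t}.Countable := by
  have hsub : {t | Function.leftLim x t ≠ x t} ⊆
      ⋃ n : ℕ, {t | 1 / ((n : ℝ) + 1) < ‖Function.leftLim x t - x t‖} := fun t ht => by
    obtain ⟨n, hn⟩ := exists_nat_one_div_lt (norm_pos_iff.mpr (sub_ne_zero.mpr ht))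
    exact mem_iUnion.mpr ⟨n, hn⟩
  refine Countable.mono hsub (countable_iUnion fun n => Finite.countable ?_)
  by_contra hinf
  obtain ⟨t, ht⟩ := Set.Infinite.exists_accPt_principal hinf
  rw [accPt_iff_frequently_nhdsNE] at ht
  refine ht ?_
  have hpos : (0 : ℝ) < 1 / ((n : ℝ) + 1) := by positivity
  have key : ∀ {F : Filter (Icc (0 : ℝ) T)} {y : X}, Tendsto (Function.leftLim x) F (𝓝 y) →
      Tendsto x F (𝓝 y) →
      ∀ᶠ s in F, ¬ s ∈ {t | 1 / ((n : ℝ) + 1) < ‖Function.leftLim x t - x t‖} := by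
    intro F y h1 h2
    have h3 := (h1.sub h2).norm
    rw [sub_self, norm_zero] at h3
    filter_upwards [h3.eventually (gt_mem_nhds hpos)] with s hs hs'
    exact lt_asymm hs hs'
  rw [← nhdsLT_sup_nhdsGT]
  exact eventually_sup.mpr ⟨key (x.tendsto_leftLim_nhdsLT t) (x.tendsto_leftLim t),
    key (x.tendsto_leftLim_nhdsGT t) (x.tendsto_nhdsGT t)⟩

/-- Every càdlàg path in a normed space has an arc. -/
theorem CadlagPath.exists_isArc (hT : 0 < T) (x : CadlagPath T X) : ∃ l, x.IsArc l := by
  obtain ⟨c, m, hc0, hcJ, hlt, hm0, hml, hmr⟩ := exists_clock x.countable_jumps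
  have hcz : ∀ t, c t = 0 → Function.leftLim x t = x t := fun t ht => by
    by_contra h
    exact (hcJ t).mpr h ht
  set tT : Icc (0 : ℝ) T := ⟨T, hT.le, le_rfl⟩
  set S := m tT + c tT with hS
  have hSpos : 0 < S := by
    have h := hlt ⟨0, le_rfl, hT.le⟩ tT (show (0 : ℝ) < T from hT)
    rw [hm0 _ rfl] at h
    have := hc0 ⟨0, le_rfl, hT.le⟩
    have := hc0 tT
    have e : ((tT : Icc (0 : ℝ) T) : ℝ) = T := rfl
    rw [e] at h
    simp only [sub_zero] at h
    linarith
  have hinv : ∀ u : Icc (0 : ℝ) 1, ∃ t, m t ≤ S * u ∧ S * u ≤ m t + c t := fun u =>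
    exists_clock_inverse hT.le hm0 hml hmr (mul_nonneg hSpos.le u.2.1)
      (mul_le_of_le_one_right hSpos.le u.2.2)
  choose τ hτ1 hτ2 using hinv
  have htime : ∀ u u' : Icc (0 : ℝ) 1, u ≤ u' → τ u ≤ τ u' := fun u u' h => by
    by_contra h'
    have h1 := hlt _ _ (not_le.mp h')
    have h2 : S * (u : ℝ) ≤ S * u' := mul_le_mul_of_nonneg_left h hSpos.le
    have h3 : (τ u' : ℝ) < τ u := not_le.mp h'
    linarith [hτ1 u, hτ2 u']
  have huniq : ∀ (u : Icc (0 : ℝ) 1) t, m t ≤ S * u → S * u ≤ m t + c t → τ u = t :=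
    fun u t h1 h2 => by
      rcases lt_trichotomy (τ u) t with h | h | h
      · have h3 : (τ u : ℝ) < t := h
        linarith [hlt _ _ h, hτ2 u]
      · exact h
      · have h3 : (t : ℝ) < τ u := h
        linarith [hlt _ _ h, hτ1 u]
  have hτlip : ∀ u u' : Icc (0 : ℝ) 1, u ≤ u' → (τ u' : ℝ) - τ u ≤ S * u' - S * u := by
    intro u u' h
    rcases eq_or_lt_of_le (htime u u' h) with h1 | h1
    · rw [h1, sub_self]
      have h2 : S * (u : ℝ) ≤ S * u' := mul_le_mul_of_nonneg_left h hSpos.le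
      linarith
    · linarith [hlt _ _ h1, hτ1 u', hτ2 u]
  have hτc : Continuous τ := by
    refine (LipschitzWith.of_dist_le_mul (K := ⟨S, hSpos.le⟩) fun u u' => ?_).continuous
    change |(τ u : ℝ) - τ u'| ≤ S * |(u : ℝ) - u'|
    rcases le_total u u' with h | h
    · have h' : (u : ℝ) ≤ u' := h
      have h'' : (τ u : ℝ) ≤ τ u' := htime _ _ h
      rw [abs_sub_comm, abs_of_nonneg (by linarith), abs_sub_comm, abs_of_nonneg (by linarith)]
      linarith [hτlip _ _ h]
    · have h' : (u' : ℝ) ≤ u := h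
      have h'' : (τ u' : ℝ) ≤ τ u := htime _ _ h
      rw [abs_of_nonneg (by linarith), abs_of_nonneg (by linarith)]
      linarith [hτlip _ _ h]
  -- The fraction of the jump at time `τ u` already covered. Without a jump the division by zero
  -- gives `0`, which is harmless because the two end points coincide.
  let a : Icc (0 : ℝ) 1 → ℝ := fun u => (S * u - m (τ u)) / c (τ u)
  have ha : ∀ u, a u ∈ Icc (0 : ℝ) 1 := fun u =>
    ⟨div_nonneg (by linarith [hτ1 u]) (hc0 _),
      div_le_one_of_le₀ (by linarith [hτ2 u]) (hc0 _)⟩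
  let z : Icc (0 : ℝ) 1 → X := fun u => (1 - a u) • Function.leftLim x (τ u) + a u • x (τ u)
  have hz0 : ∀ u, S * u = m (τ u) → z u = Function.leftLim x (τ u) := fun u h => by
    have : a u = 0 := by simp [a, h]
    simp [z, this]
  have hz1 : ∀ u, S * u = m (τ u) + c (τ u) → z u = x (τ u) := fun u h => by
    by_cases hcu : c (τ u) = 0
    · simp only [z, hcz _ hcu, ← add_smul]
      simp
    · have : a u = 1 := by simp [a, h, hcu]
      simp [z, this]
  have hzc : Continuous z := by
    rw [continuous_iff_continuousAt]
    intro u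
    have haff : Continuous fun v : Icc (0 : ℝ) 1 =>
        (1 - (S * v - m (τ u)) / c (τ u)) • Function.leftLim x (τ u) +
          ((S * v - m (τ u)) / c (τ u)) • x (τ u) := by fun_prop
    have hSc : Continuous fun v : Icc (0 : ℝ) 1 => S * (v : ℝ) := by fun_prop
    have haffeq : ∀ v, τ v = τ u → (1 - (S * v - m (τ u)) / c (τ u)) • Function.leftLim x (τ u) +
          ((S * v - m (τ u)) / c (τ u)) • x (τ u) = z v := fun v hv => by simp only [z, a, hv]
    -- On each side of `u` there are two cases. Either the clock interval of `τ u` continues and `z`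
    -- is locally affine, or `τ` approaches `τ u` strictly from that side and the path and its left
    -- limits have a common limit.
    refine continuousAt_iff_continuous_left'_right'.mpr ⟨?_, ?_⟩
    · rcases eq_or_lt_of_le (hτ1 u) with h | h
      · have hin : Tendsto τ (𝓝[<] u) (𝓝[<] (τ u)) := by
          refine tendsto_nhdsWithin_of_tendsto_nhds_of_eventually_within _
            (hτc.continuousAt.mono_left nhdsWithin_le_nhds) ?_
          filter_upwards [self_mem_nhdsWithin] with v hv
          refine lt_of_le_of_ne (htime _ _ (le_of_lt hv)) fun h' => ?_
          have h1 := hτ1 v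
          rw [h', h] at h1
          have : (v : ℝ) < u := hv
          linarith [mul_lt_mul_of_pos_left this hSpos]
        change Tendsto z _ (𝓝 (z u))
        rw [hz0 u h.symm]
        exact tendsto_convexComb ha ((x.tendsto_leftLim_nhdsLT _).comp hin)
          ((x.tendsto_leftLim _).comp hin)
      · have : ∀ᶠ v in 𝓝[<] u, τ v = τ u := by
          filter_upwards [self_mem_nhdsWithin, nhdsWithin_le_nhds
            (hSc.continuousAt.eventually (lt_mem_nhds h))] with v hv hv'
          refine huniq v _ hv'.le ?_
          have : (v : ℝ) < u := hv
          linarith [mul_lt_mul_of_pos_left this hSpos, hτ2 u]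
        refine (haff.continuousAt.continuousWithinAt).congr_of_eventuallyEq ?_ (haffeq u rfl).symm
        filter_upwards [this] with v hv using (haffeq v hv).symm
    · rcases eq_or_lt_of_le (hτ2 u) with h | h
      · have hin : Tendsto τ (𝓝[>] u) (𝓝[>] (τ u)) := by
          refine tendsto_nhdsWithin_of_tendsto_nhds_of_eventually_within _
            (hτc.continuousAt.mono_left nhdsWithin_le_nhds) ?_
          filter_upwards [self_mem_nhdsWithin] with v hv
          refine lt_of_le_of_ne (htime _ _ (le_of_lt hv)) fun h' => ?_
          have h1 := hτ2 v
          rw [← h', ← h] at h1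
          have : (u : ℝ) < v := hv
          linarith [mul_lt_mul_of_pos_left this hSpos]
        change Tendsto z _ (𝓝 (z u))
        rw [hz1 u h]
        exact tendsto_convexComb ha ((x.tendsto_leftLim_nhdsGT _).comp hin)
          ((x.tendsto_nhdsGT _).comp hin)
      · have : ∀ᶠ v in 𝓝[>] u, τ v = τ u := by
          filter_upwards [self_mem_nhdsWithin, nhdsWithin_le_nhds
            (hSc.continuousAt.eventually (gt_mem_nhds h))] with v hv hv'
          refine huniq v _ ?_ (le_of_lt hv')
          have : (u : ℝ) < v := hv
          linarith [mul_lt_mul_of_pos_left this hSpos, hτ1 u]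
        refine (haff.continuousAt.continuousWithinAt).congr_of_eventuallyEq ?_ (haffeq u rfl).symm
        filter_upwards [this] with v hv using (haffeq v hv).symm
  refine ⟨fun u => (z u, τ u), ⟨hzc.prodMk hτc, ?_, ?_⟩, ?_⟩
  · ext ⟨w, t⟩
    constructor
    · rintro ⟨u, hu⟩
      simp only [Prod.mk.injEq] at hu
      refine ⟨a u, ha u, ?_⟩
      rw [← hu.1, ← hu.2]
    · rintro ⟨b, hb, hw⟩
      have hmt : 0 ≤ m t := by
        rcases eq_or_lt_of_le t.2.1 with h | h
        · exact (hm0 t h.symm).ge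
        · have h1 := hlt ⟨0, le_rfl, hT.le⟩ t h
          rw [hm0 _ rfl] at h1
          have h2 := hc0 ⟨0, le_rfl, hT.le⟩
          simp only [sub_zero] at h1
          linarith
      have hmS : m t + c t ≤ S := by
        rcases eq_or_lt_of_le (show t ≤ tT from t.2.2) with h | h
        · rw [h]
        · have h1 := hlt _ _ h
          have h2 : (t : ℝ) < tT := h
          linarith [hc0 tT]
      have hbc : b * c t ≤ c t := mul_le_of_le_one_left (hc0 t) hb.2
      have hbc0 : 0 ≤ b * c t := mul_nonneg hb.1 (hc0 t)
      let u : Icc (0 : ℝ) 1 := ⟨(m t + b * c t) / S, div_nonneg (by linarith) hSpos.le,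
        div_le_one_of_le₀ (by linarith) hSpos.le⟩
      have hSu : S * u = m t + b * c t := mul_div_cancel₀ _ hSpos.ne'
      have hτu : τ u = t := huniq u t (by linarith) (by linarith)
      refine ⟨u, Prod.ext ?_ hτu⟩
      simp only at hw
      simp only [hw, z, hτu]
      by_cases hct : c t = 0
      · rw [hcz t hct, ← add_smul, ← add_smul]; simp
      · have : a u = b := by
          simp only [a, hτu, hSu]
          field_simp
          ring
        rw [this]
  · intro u u' h
    rcases eq_or_lt_of_le (htime u u' h) with h1 | h1
    · refine Or.inr ⟨h1, a u, ha u, a u', ha u', ?_, rfl, ?_⟩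
      · simp only [a, h1]
        have h2 : S * (u : ℝ) ≤ S * u' := mul_le_mul_of_nonneg_left h hSpos.le
        exact div_le_div_of_nonneg_right (by linarith) (hc0 _)
      · simp only [z, h1]
    · exact Or.inl h1
  · intro u u' h
    simp only [Prod.mk.injEq] at h
    obtain ⟨h1, h2⟩ := h
    have hSS : S * (u : ℝ) = S * u' := by
      by_cases hct : c (τ u) = 0
      · have e1 := hτ1 u; have e2 := hτ2 u; have e3 := hτ1 u'; have e4 := hτ2 u'
        rw [← h2] at e3 e4
        linarith
      · have hne := (hcJ _).mp hct
        have h3 : (a u - a u') • (x (τ u) - Function.leftLim x (τ u)) = 0 := by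
          have h4 := sub_eq_zero.mpr h1
          rw [← h4]
          simp only [z, ← h2]
          module
        rcases smul_eq_zero.mp h3 with h4 | h4
        · have h5 : a u = a u' := by linarith
          simp only [a, ← h2] at h5
          field_simp at h5
          linarith
        · exact absurd (sub_eq_zero.mp h4).symm hne
    exact Subtype.ext (mul_left_cancel₀ hSpos.ne' hSS)

end Arc


/-! ### The M1 topology -/

section M1Topology

variable {T : ℝ} {X Y : Type*} [AddCommGroup X] [Module ℝ X] [TopologicalSpace X]
  [AddCommGroup Y] [Module ℝ Y] [TopologicalSpace Y]

/-- It suffices to treat the generating balls. The triangle inequality is used only in the target,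
so arcs are required there, while in the source any parametric representations suffice. -/
theorem continuous_map_m1Topology [IsTopologicalAddGroup X] [IsTopologicalAddGroup Y] [T2Space Y]
    {ι κ : Type*} {q : ι → Seminorm ℝ X} {q' : κ → Seminorm ℝ Y} (hq : ∀ i, Continuous (q i))
    (hq' : ∀ k, Continuous (q' k)) (hX : ∀ x : CadlagPath T X, x.paramReps.Nonempty)
    (hY : ∀ y : CadlagPath T Y, ∃ l, y.IsArc l) {f : X → Y} (hf : Continuous f)
    (hl : IsLinearMap ℝ f) (hb : ∀ k, ∃ i C, 1 ≤ C ∧ ∀ z, q' k (f z) ≤ C * q i z) :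
    Continuous[m1Topology fun i => ⇑(q i), m1Topology fun k => ⇑(q' k)]
      (CadlagPath.map (T := T) f hf) := by
  let τ : TopologicalSpace (CadlagPath T X) := m1Topology fun i => ⇑(q i)
  refine continuous_generateFrom_iff.mpr ?_
  rintro _ ⟨k, y₀, ε, hε, rfl⟩
  obtain ⟨i, C, hC, hb⟩ := hb k
  have hC0 : 0 < C := by linarith
  rw [isOpen_iff_forall_mem_open]
  intro x hx
  change m1Dist (q' k) (x.map f hf) y₀ < ε at hx
  set r := (ε - m1Dist (q' k) (x.map f hf) y₀) / C with hr
  have hr0 : 0 < r := div_pos (by linarith) hC0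
  refine ⟨{x' | m1Dist (q i) x' x < r}, fun x' hx' => ?_,
    TopologicalSpace.isOpen_generateFrom_of_mem ⟨i, x, r, hr0, rfl⟩, ?_⟩
  · change m1Dist (q' k) (x'.map f hf) y₀ < ε
    have h1 := m1Dist_map_le (hq i) hC hf hl hb (hX x') (hX x)
    have h2 := m1Dist_triangle (hq' k) (hY (x'.map f hf)) (hY (x.map f hf)) (hY y₀)
    have h3 : C * m1Dist (q i) x' x < C * r := mul_lt_mul_of_pos_left hx' hC0
    rw [hr, mul_div_cancel₀ _ hC0.ne'] at h3
    linarith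
  · change m1Dist (q i) x x < r
    rw [m1Dist_self _ (hX x)]; exact hr0

end M1Topology

/-! ### The M1 metric for paths in a normed space. -/

section Normed

variable {T : ℝ} {X : Type*} [NormedAddCommGroup X] [NormedSpace ℝ X]

theorem graphDist_norm_eq_dist (w v : X × Icc (0 : ℝ) T) :
    graphDist (normSeminorm ℝ X) w v = dist w v := by
  rw [Prod.dist_eq, dist_eq_norm, Subtype.dist_eq, Real.dist_eq]; rfl

/-- The M1 pseudometric on the càdlàg paths in a normed space. -/
noncomputable abbrev m1PseudoMetricSpace (hT : 0 < T) (X : Type*) [NormedAddCommGroup X] [NormedSpace ℝ X] :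
    PseudoMetricSpace (CadlagPath T X) where
  dist := m1Dist (normSeminorm ℝ X)
  dist_self x := m1Dist_self _ ((x.exists_isArc hT).imp fun _ h => h.1)
  dist_comm x y := m1Dist_comm _ x y
  dist_triangle x y z := m1Dist_triangle (by exact continuous_norm) (x.exists_isArc hT)
    (y.exists_isArc hT) (z.exists_isArc hT)

theorem m1TopologyNormed_eq (hT : 0 < T) :
    m1TopologyNormed T X = (m1PseudoMetricSpace hT X).toUniformSpace.toTopologicalSpace := by
  let := m1PseudoMetricSpace hT X
  refine le_antisymm ?_ (le_generateFrom ?_)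
  · intro U hU
    rw [Metric.isOpen_iff] at hU
    let τ : TopologicalSpace (CadlagPath T X) := m1TopologyNormed T X
    rw [isOpen_iff_forall_mem_open]
    intro x hx
    obtain ⟨ε, hε, h⟩ := hU x hx
    exact ⟨_, h, TopologicalSpace.isOpen_generateFrom_of_mem ⟨(), x, ε, hε, rfl⟩,
      Metric.mem_ball_self hε⟩
  · rintro _ ⟨-, x, ε, hε, rfl⟩
    exact Metric.isOpen_ball (x := x) (ε := ε)

/-- Just after a time `t < T`, the value of `x` lies on a jump segment of `y`, and both ends of that
segment tend to `y t`. At `T` the left limits agree, and each end point lies on the segment from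
this common point to the other, which forces them to coincide. -/
theorem CadlagPath.eq_of_graph_eq (hT : 0 < T) {x y : CadlagPath T X} (h : x.graph = y.graph) :
    x = y := by
  have hlt : ∀ t : Icc (0 : ℝ) T, (t : ℝ) < T → x t = y t := fun t ht => by
    have hne : (𝓝[>] t).NeBot :=
      nhdsGT_neBot_of_exists_gt ⟨(⟨T, hT.le, le_rfl⟩ : Icc (0 : ℝ) T), ht⟩
    have hmem : ∀ s, ∃ a ∈ Icc (0 : ℝ) 1, x s = (1 - a) • Function.leftLim y s + a • y s :=
      fun s => by
        have := x.mem_graph s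
        rwa [h] at this
    choose a ha hxa using hmem
    refine tendsto_nhds_unique (x.tendsto_nhdsGT t) ?_
    have h1 := tendsto_convexComb (X := X) ha (y.tendsto_leftLim_nhdsGT t) (y.tendsto_nhdsGT t)
    exact h1.congr fun s => (hxa s).symm
  refine CadlagPath.ext fun t => ?_
  rcases lt_or_eq_of_le t.2.2 with ht | ht
  · exact hlt t ht
  have hne : (𝓝[<] t).NeBot := by
    refine nhdsLT_neBot_of_exists_lt ⟨(⟨0, le_rfl, hT.le⟩ : Icc (0 : ℝ) T), ?_⟩
    change (0 : ℝ) < t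
    rw [ht]; exact hT
  have hleft : Function.leftLim x t = Function.leftLim y t := by
    refine tendsto_nhds_unique (x.tendsto_leftLim t) ((y.tendsto_leftLim t).congr' ?_)
    filter_upwards [self_mem_nhdsWithin] with s hs
    have hs' : (s : ℝ) < t := hs
    exact (hlt s (by linarith)).symm
  obtain ⟨a, ha, hxa⟩ : (x t, t) ∈ y.graph := h ▸ x.mem_graph t
  obtain ⟨b, hb, hyb⟩ : (y t, t) ∈ x.graph := h ▸ y.mem_graph t
  simp only at hxa hyb
  rw [hleft] at hyb
  set p := Function.leftLim y t
  have h1 : x t - p = a • (y t - p) := by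
    rw [hxa]
    have e : ∀ u : X, (1 - a) • p + a • u - p = a • (u - p) := fun u => by module
    exact e _
  have h2 : y t - p = b • (x t - p) := by
    rw [hyb]
    have e : ∀ u : X, (1 - b) • p + b • u - p = b • (u - p) := fun u => by module
    exact e _
  have h3 : (1 - a * b) • (x t - p) = 0 := by
    rw [sub_smul, mul_smul, ← h2, ← h1, one_smul, sub_self]
  rcases smul_eq_zero.mp h3 with h4 | h4
  · have : a = 1 := by nlinarith [ha.1, ha.2, hb.1, hb.2]
    rw [this, one_smul] at h1
    exact sub_left_injective h1
  · rw [h4, smul_zero] at h2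
    exact sub_left_injective (h4.trans h2.symm)

/-- Graphs are compact, hence closed, and distance zero puts each graph in the closure of the other.
-/
theorem CadlagPath.eq_of_m1Dist_eq_zero (hT : 0 < T) {x y : CadlagPath T X}
    (h : m1Dist (normSeminorm ℝ X) x y = 0) : x = y := by
  have key : ∀ {x y : CadlagPath T X}, m1Dist (normSeminorm ℝ X) x y = 0 →
      x.graph ⊆ y.graph := by
    intro x y h
    obtain ⟨lx, hx⟩ := x.exists_isArc hT
    obtain ⟨ly, hy⟩ := y.exists_isArc hT
    rw [← hx.1.2.1, ← hy.1.2.1]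
    rintro _ ⟨s, rfl⟩
    rw [← (isCompact_range hy.1.1).isClosed.closure_eq]
    refine Metric.mem_closure_iff.mpr fun ε hε => ?_
    obtain ⟨ψ, hψ⟩ := exists_orderIso_of_m1Dist_lt (by exact continuous_norm) hx hy
      (h.trans_lt hε)
    exact ⟨_, mem_range_self (ψ s), by rw [← graphDist_norm_eq_dist]; exact hψ s⟩
  exact eq_of_graph_eq hT (Subset.antisymm (key h) (key ((m1Dist_comm _ _ _).trans h)))

theorem t2Space_m1TopologyNormed (hT : 0 < T) : @T2Space _ (m1TopologyNormed T X) := by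
  let := m1PseudoMetricSpace hT X
  rw [m1TopologyNormed_eq hT]
  let : MetricSpace (CadlagPath T X) :=
    { m1PseudoMetricSpace hT X with eq_of_dist_eq_zero := CadlagPath.eq_of_m1Dist_eq_zero hT }
  exact inferInstance

end Normed


/-! ### Matching of paths with small oscillation -/

section MonoJoined

variable {α : Type*} [TopologicalSpace α] [Preorder α]

/-- `p` and `q` are joined by a monotone path inside `R`. -/
def MonoJoined (R : Set α) (p q : α) : Prop :=
  ∃ γ : Path p q, Monotone γ ∧ ∀ u, γ u ∈ R

theorem MonoJoined.refl {R : Set α} {p : α} (hp : p ∈ R) : MonoJoined R p p :=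
  ⟨Path.refl p, fun _ _ _ => le_rfl, fun _ => hp⟩

theorem MonoJoined.trans {R : Set α} {p q r : α} (h : MonoJoined R p q) (h' : MonoJoined R q r) :
    MonoJoined R p r := by
  obtain ⟨γ, hm, hR⟩ := h
  obtain ⟨γ', hm', hR'⟩ := h'
  refine ⟨γ.trans γ', fun s t hst => ?_, fun u => ?_⟩
  · have hst' : (s : ℝ) ≤ t := hst
    have e1 : ∀ u, γ u ≤ q := fun u => by
      have := hm (show u ≤ 1 from u.2.2)
      rwa [γ.target] at this
    have e2 : ∀ u, q ≤ γ' u := fun u => by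
      have := hm' (show 0 ≤ u from u.2.1)
      rwa [γ'.source] at this
    rw [Path.trans_apply, Path.trans_apply]
    split_ifs with h1 h2 h2
    · exact hm (Subtype.mk_le_mk.mpr (by linarith))
    · exact (e1 _).trans (e2 _)
    · exact absurd (hst'.trans h2) h1
    · exact hm' (Subtype.mk_le_mk.mpr (by linarith))
  · rw [Path.trans_apply]
    split_ifs
    · exact hR _
    · exact hR' _

end MonoJoined

section Osc

variable {T : ℝ} {X : Type*} [NormedAddCommGroup X] [NormedSpace ℝ X]

/-- A curve which, for any three successive times, is `ε`-close to the segment between the outer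
values at the middle time, runs `4 ε`-closely along the segment between its end points. -/
theorem exists_orderIso_segment {f : Icc (0 : ℝ) 1 → X} (hf : Continuous f) {ε : ℝ} (hε : 0 < ε)
    (h : ∀ s₁ s₂ s₃, s₁ ≤ s₂ → s₂ ≤ s₃ → ∃ w ∈ segment ℝ (f s₁) (f s₃), ‖f s₂ - w‖ ≤ ε) :
    ∃ ψ : Icc (0 : ℝ) 1 ≃o Icc (0 : ℝ) 1, ∀ s,
      ‖f s - (f 0 + (ψ s : ℝ) • (f 1 - f 0))‖ ≤ 4 * ε := by
  set L := ‖f 1 - f 0‖ with hL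
  have hL0 : 0 ≤ L := norm_nonneg _
  have hseg : ∀ s₁ s₂ s₃, s₁ ≤ s₂ → s₂ ≤ s₃ →
      ∃ c ∈ Icc (0 : ℝ) 1, ‖f s₂ - (f s₁ + c • (f s₃ - f s₁))‖ ≤ ε := fun s₁ s₂ s₃ h1 h2 => by
    obtain ⟨w, hw, hd⟩ := h s₁ s₂ s₃ h1 h2
    rw [segment_eq_image'] at hw
    obtain ⟨c, hc, rfl⟩ := hw
    exact ⟨c, hc, hd⟩
  -- A monotone surjection with error `3 * ε` suffices, since the last `ε` pays for an order
  -- isomorphism within `ε / (L + 1)` of it. The `+ 1` covers `L = 0`.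
  suffices H : ∃ H : Icc (0 : ℝ) 1 → Icc (0 : ℝ) 1, Continuous H ∧ Monotone H ∧
      Function.Surjective H ∧ ∀ s, ‖f s - (f 0 + (H s : ℝ) • (f 1 - f 0))‖ ≤ 3 * ε by
    obtain ⟨H, hc, hm, hs, hH⟩ := H
    obtain ⟨ψ, hψ⟩ := exists_orderIso_near hc hm hs (show 0 < ε / (L + 1) by positivity)
    refine ⟨ψ, fun s => ?_⟩
    have e : f s - (f 0 + (ψ s : ℝ) • (f 1 - f 0)) = (f s - (f 0 + (H s : ℝ) • (f 1 - f 0))) -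
      ((ψ s : ℝ) - H s) • (f 1 - f 0) := by module
    rw [e]
    refine (norm_sub_le _ _).trans ?_
    rw [norm_smul, ← hL]
    have h1 : ‖(ψ s : ℝ) - H s‖ < ε / (L + 1) := hψ s
    have h2 : ‖(ψ s : ℝ) - H s‖ * (L + 1) ≤ ε := by
      rw [lt_div_iff₀ (by positivity)] at h1; exact h1.le
    have h3 := norm_nonneg ((ψ s : ℝ) - H s)
    have h4 := hH s
    nlinarith
  rcases eq_or_lt_of_le hL0 with hz | hz
  · refine ⟨id, continuous_id, monotone_id, Function.surjective_id, fun s => ?_⟩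
    have h0 : f 1 - f 0 = 0 := norm_eq_zero.mp (hL ▸ hz.symm)
    obtain ⟨c, -, hd⟩ := hseg 0 s 1 s.2.1 s.2.2
    rw [h0, smul_zero] at hd ⊢
    linarith
  · set g : Icc (0 : ℝ) 1 → ℝ := fun s => ‖f s - f 0‖ with hg
    have hgc : Continuous g := by fun_prop
    -- The running maximum of the distance from `f 0`. It is monotone, and the three-point condition
    -- with first point `0` keeps it within `ε` of that distance. Divided by `L` and capped at `1`,
    -- it measures progress along the chord.
    set G : Icc (0 : ℝ) 1 → ℝ := fun s => sSup ((fun θ => g (min θ s)) '' univ) with hG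
    have hGc : Continuous G := by
      refine isCompact_univ.continuous_sSup (f := fun s θ => g (min θ s)) ?_
      exact hgc.comp (continuous_snd.min continuous_fst)
    have hbdd : ∀ s, BddAbove ((fun θ => g (min θ s)) '' univ) := fun s =>
      (isCompact_univ.image (hgc.comp (continuous_id.min continuous_const))).bddAbove
    have hle : ∀ r s, r ≤ s → g r ≤ G s := fun r s hrs =>
      le_csSup (hbdd s) ⟨r, mem_univ _, by simp only [min_eq_left hrs]⟩
    have hGle : ∀ s C, (∀ r ≤ s, g r ≤ C) → G s ≤ C := fun s C hC =>
      csSup_le (univ_nonempty.image _) (by rintro _ ⟨θ, -, rfl⟩; exact hC _ (min_le_right _ _))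
    have hGm : Monotone G := fun s s' hs => hGle _ _ fun r hr => hle _ _ (hr.trans hs)
    have hGg : ∀ s, G s ≤ g s + ε := fun s => hGle _ _ fun r hr => by
      obtain ⟨c, hc, hd⟩ := hseg 0 r s r.2.1 hr
      have e : f r - f 0 = (f r - (f 0 + c • (f s - f 0))) + c • (f s - f 0) := by abel
      calc g r = ‖(f r - (f 0 + c • (f s - f 0))) + c • (f s - f 0)‖ := by rw [← e]
        _ ≤ ε + c * g s := by
          refine (norm_add_le _ _).trans (add_le_add hd ?_)
          rw [norm_smul, Real.norm_of_nonneg hc.1]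
        _ ≤ g s + ε := by
          have := mul_le_of_le_one_left (norm_nonneg (f s - f 0)) hc.2
          simp only [hg]; linarith
    have hG0 : G 0 = 0 := by
      refine le_antisymm (hGle _ _ fun r hr => ?_) ?_
      · have : r = 0 := le_antisymm hr r.2.1
        simp [hg, this]
      · exact (norm_nonneg _).trans (hle 0 0 le_rfl)
    have hGnn : ∀ s, 0 ≤ G s := fun s => hG0 ▸ hGm (show (0 : Icc (0 : ℝ) 1) ≤ s from s.2.1)
    let H : Icc (0 : ℝ) 1 → Icc (0 : ℝ) 1 := fun s =>
      ⟨min (G s / L) 1, le_min (div_nonneg (hGnn s) hL0) zero_le_one, min_le_right _ _⟩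
    have hHc : Continuous H := Continuous.subtype_mk ((hGc.div_const L).min continuous_const) _
    refine ⟨H, hHc, fun s s' hs => ?_, surjective_of_continuous_zero_one hHc ?_ ?_, fun s => ?_⟩
    · exact Subtype.mk_le_mk.mpr
        (min_le_min_right _ (div_le_div_of_nonneg_right (hGm hs) hL0))
    · exact Subtype.ext (by simp [H, hG0])
    · refine Subtype.ext (min_eq_right ?_)
      rw [le_div_iff₀ hz, one_mul]
      exact hle 1 1 le_rfl
    · obtain ⟨c, hc, hd⟩ := hseg 0 s 1 s.2.1 s.2.2
      have hgs : |g s - c * L| ≤ ε := by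
        have e : ‖c • (f 1 - f 0)‖ = c * L := by rw [norm_smul, Real.norm_of_nonneg hc.1]
        rw [← e]
        refine (abs_norm_sub_norm_le _ _).trans (le_trans (le_of_eq ?_) hd)
        congr 1; abel
      rw [abs_le] at hgs
      have h1 := hle s s le_rfl
      have h2 := hGg s
      have hHL : (H s : ℝ) * L = min (G s) L := by
        change min (G s / L) 1 * L = _
        rw [min_mul_of_nonneg _ _ hL0, div_mul_cancel₀ _ hz.ne', one_mul]
      have hcL : c * L ≤ L := mul_le_of_le_one_left hL0 hc.2
      have h3 : |c * L - H s * L| ≤ 2 * ε := by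
        rw [hHL, abs_le]
        constructor
        · have := min_le_left (G s) L; linarith
        · have : c * L - 2 * ε ≤ min (G s) L := le_min (by linarith) (by linarith)
          linarith
      have e : f s - (f 0 + (H s : ℝ) • (f 1 - f 0)) = (f s - (f 0 + c • (f 1 - f 0))) +
        (c - H s) • (f 1 - f 0) := by module
      rw [e]
      refine (norm_add_le _ _).trans ?_
      rw [norm_smul, Real.norm_eq_abs, ← hL, ← abs_of_nonneg hL0, ← abs_mul, sub_mul]
      linarith

/-- For any three successive points of the curve `l` within a time span `δ`, the middle one is
`ε`-close to the segment between the other ones. -/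
def SegOsc (l : Icc (0 : ℝ) 1 → X × Icc (0 : ℝ) T) (δ ε : ℝ) : Prop :=
  ∀ s₁ s₂ s₃, s₁ ≤ s₂ → s₂ ≤ s₃ → ((l s₃).2 : ℝ) - (l s₁).2 ≤ δ →
    ∃ w ∈ segment ℝ (l s₁).1 (l s₃).1, ‖(l s₂).1 - w‖ ≤ ε

/-- The affine map of the unit interval onto its subinterval `[a, b]`. -/
def affineUnit (a b s : Icc (0 : ℝ) 1) : Icc (0 : ℝ) 1 :=
  ⟨(1 - s) * a + s * b, by
    have := s.2.1; have := s.2.2; have := a.2.1; have := b.2.1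
    have : (0 : ℝ) ≤ 1 - s := by linarith
    positivity, by
    have := s.2.1; have := s.2.2; have := a.2.2; have := b.2.2
    nlinarith⟩

theorem continuous_affineUnit (a b : Icc (0 : ℝ) 1) : Continuous (affineUnit a b) :=
  Continuous.subtype_mk (by fun_prop) _

theorem affineUnit_zero (a b : Icc (0 : ℝ) 1) : affineUnit a b 0 = a :=
  Subtype.ext (by simp [affineUnit])

theorem affineUnit_one (a b : Icc (0 : ℝ) 1) : affineUnit a b 1 = b :=
  Subtype.ext (by simp [affineUnit])

theorem monotone_affineUnit {a b : Icc (0 : ℝ) 1} (h : a ≤ b) : Monotone (affineUnit a b) :=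
  fun s s' hs => by
    have h1 : (a : ℝ) ≤ b := h
    have h2 : (s : ℝ) ≤ s' := hs
    refine Subtype.mk_le_mk.mpr ?_
    nlinarith

/-- Each curve follows its own chord with error `4 * ε`, and the chords at equal parameters are
`ε`-close because their end points are, hence `9 * ε`. All times involved lie in one interval of
length at most `δ`. -/
theorem monoJoined_of_segOsc {l l' : Icc (0 : ℝ) 1 → X × Icc (0 : ℝ) T} (hl : Continuous l)
    (hl' : Continuous l') (hm : Monotone fun s => (l s).2) (hm' : Monotone fun s => (l' s).2)
    {δ ε : ℝ} (hε : 0 < ε) (ho : SegOsc l δ ε) (ho' : SegOsc l' δ ε)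
    {a b a' b' : Icc (0 : ℝ) 1} (hab : a ≤ b) (hab' : a' ≤ b')
    (ha : (l a).2 = (l' a').2) (hb : (l b).2 = (l' b').2)
    (hδ : ((l b).2 : ℝ) - (l a).2 ≤ δ) (hda : ‖(l a).1 - (l' a').1‖ ≤ ε)
    (hdb : ‖(l b).1 - (l' b').1‖ ≤ ε) :
    MonoJoined {u | graphDist (normSeminorm ℝ X) (l u.1) (l' u.2) ≤ max (9 * ε) δ}
      (a, a') (b, b') := by
  have key : ∀ {l : Icc (0 : ℝ) 1 → X × Icc (0 : ℝ) T} {a b : Icc (0 : ℝ) 1}, Continuous l →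
      Monotone (fun s => (l s).2) → SegOsc l δ ε → a ≤ b → ((l b).2 : ℝ) - (l a).2 ≤ δ →
      ∃ ψ : Icc (0 : ℝ) 1 ≃o Icc (0 : ℝ) 1, ∀ s, ‖(l (affineUnit a b s)).1 -
        ((l a).1 + (ψ s : ℝ) • ((l b).1 - (l a).1))‖ ≤ 4 * ε := by
    intro l a b hl hm ho hab hδ
    have h := exists_orderIso_segment (f := fun s => (l (affineUnit a b s)).1)
      (continuous_fst.comp (hl.comp (continuous_affineUnit a b))) hε
      (fun s₁ s₂ s₃ h1 h2 => ho _ _ _ (monotone_affineUnit hab h1) (monotone_affineUnit hab h2) (by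
        have e1 : (l (affineUnit a b s₃)).2 ≤ (l b).2 := hm (by
          rw [← affineUnit_one a b, affineUnit_one a b]
          have := monotone_affineUnit hab (show s₃ ≤ 1 from s₃.2.2)
          rwa [affineUnit_one] at this)
        have e2 : (l a).2 ≤ (l (affineUnit a b s₁)).2 := hm (by
          have := monotone_affineUnit hab (show 0 ≤ s₁ from s₁.2.1)
          rwa [affineUnit_zero] at this)
        have e1' : ((l (affineUnit a b s₃)).2 : ℝ) ≤ (l b).2 := e1
        have e2' : ((l a).2 : ℝ) ≤ (l (affineUnit a b s₁)).2 := e2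
        linarith))
    simpa only [affineUnit_zero, affineUnit_one] using h
  have htime : ∀ {l : Icc (0 : ℝ) 1 → X × Icc (0 : ℝ) T} {a b : Icc (0 : ℝ) 1},
      Monotone (fun s => (l s).2) → a ≤ b → ∀ s, (l a).2 ≤ (l (affineUnit a b s)).2 ∧
        (l (affineUnit a b s)).2 ≤ (l b).2 := by
    intro l a b hm hab s
    constructor
    · have := monotone_affineUnit hab (show 0 ≤ s from s.2.1)
      rw [affineUnit_zero] at this
      exact hm this
    · have := monotone_affineUnit hab (show s ≤ 1 from s.2.2)
      rw [affineUnit_one] at this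
      exact hm this
  obtain ⟨ψ, hψ⟩ := key hl hm ho hab hδ
  obtain ⟨χ, hχ⟩ := key hl' hm' ho' hab' (by rw [← ha, ← hb]; exact hδ)
  refine ⟨⟨⟨fun u => (affineUnit a b (ψ.symm u), affineUnit a' b' (χ.symm u)), ?_⟩, ?_, ?_⟩, ?_, ?_⟩
  · exact ((continuous_affineUnit a b).comp ψ.symm.toHomeomorph.continuous).prodMk
      ((continuous_affineUnit a' b').comp χ.symm.toHomeomorph.continuous)
  · have h1 : ψ.symm 0 = 0 := ψ.symm.map_bot
    have h2 : χ.symm 0 = 0 := χ.symm.map_bot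
    simp [h1, h2, affineUnit_zero]
  · have h1 : ψ.symm 1 = 1 := ψ.symm.map_top
    have h2 : χ.symm 1 = 1 := χ.symm.map_top
    simp [h1, h2, affineUnit_one]
  · intro u v huv
    exact ⟨monotone_affineUnit hab (ψ.symm.monotone huv),
      monotone_affineUnit hab' (χ.symm.monotone huv)⟩
  · intro u
    have h1 := hψ (ψ.symm u)
    have h2 := hχ (χ.symm u)
    rw [OrderIso.apply_symm_apply] at h1 h2
    change graphDist (normSeminorm ℝ X) (l (affineUnit a b (ψ.symm u)))
      (l' (affineUnit a' b' (χ.symm u))) ≤ _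
    refine max_le_max ?_ ?_
    · change ‖(l (affineUnit a b (ψ.symm u))).1 - (l' (affineUnit a' b' (χ.symm u))).1‖ ≤ _
      set P := (l (affineUnit a b (ψ.symm u))).1
      set Q := (l' (affineUnit a' b' (χ.symm u))).1
      have e : P - Q = (P - ((l a).1 + (u : ℝ) • ((l b).1 - (l a).1))) -
          (Q - ((l' a').1 + (u : ℝ) • ((l' b').1 - (l' a').1))) +
          ((1 - (u : ℝ)) • ((l a).1 - (l' a').1) + (u : ℝ) • ((l b).1 - (l' b').1)) := by module
      have hu := u.2
      have h3 : ‖(1 - (u : ℝ)) • ((l a).1 - (l' a').1) + (u : ℝ) • ((l b).1 - (l' b').1)‖ ≤ ε := by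
        refine (norm_add_le _ _).trans ?_
        rw [norm_smul, norm_smul, Real.norm_of_nonneg hu.1,
          Real.norm_of_nonneg (by linarith [hu.2])]
        nlinarith [hu.1, hu.2]
      rw [e]
      refine (norm_add_le _ _).trans ?_
      linarith [norm_sub_le (P - ((l a).1 + (u : ℝ) • ((l b).1 - (l a).1)))
          (Q - ((l' a').1 + (u : ℝ) • ((l' b').1 - (l' a').1)))]
    · obtain ⟨e1, e2⟩ := htime hm hab (ψ.symm u)
      obtain ⟨e3, e4⟩ := htime hm' hab' (χ.symm u)
      rw [← ha] at e3
      rw [← hb] at e4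
      rw [← Subtype.coe_le_coe] at e1 e2 e3 e4
      change |((l (affineUnit a b (ψ.symm u))).2 : ℝ) -
        (l' (affineUnit a' b' (χ.symm u))).2| ≤ δ
      rw [abs_le]
      constructor <;> linarith

theorem CadlagPath.arc_zero {x : CadlagPath T X} {l : Icc (0 : ℝ) 1 → X × Icc (0 : ℝ) T}
    (hl : x.IsArc l) {t : Icc (0 : ℝ) T} (ht : (t : ℝ) = 0) : l 0 = (x t, t) := by
  have hm : (x t, t) ∈ range l := by rw [hl.1.2.1]; exact x.mem_graph t
  obtain ⟨s, hs⟩ := hm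
  have h1 : (l 0).2 ≤ (l s).2 := monotone_time hl.1 (show 0 ≤ s from s.2.1)
  rw [hs] at h1
  have h2 : (l 0).2 = t := le_antisymm h1 (by rw [← Subtype.coe_le_coe, ht]; exact (l 0).2.2.1)
  obtain ⟨a, ha, he⟩ : l 0 ∈ x.graph := by rw [← hl.1.2.1]; exact mem_range_self _
  refine Prod.ext ?_ h2
  rw [he, h2, x.leftLim_zero ht, ← add_smul]
  simp

/-- The path may jump at `T`, but its value there is the greatest point of the graph, so the arc
ends in it. -/
theorem CadlagPath.arc_one {x : CadlagPath T X} {l : Icc (0 : ℝ) 1 → X × Icc (0 : ℝ) T}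
    (hl : x.IsArc l) {t : Icc (0 : ℝ) T} (ht : (t : ℝ) = T) : l 1 = (x t, t) := by
  have hm : (x t, t) ∈ range l := by rw [hl.1.2.1]; exact x.mem_graph t
  obtain ⟨s, hs⟩ := hm
  have h1 : (l s).2 ≤ (l 1).2 := monotone_time hl.1 (show s ≤ 1 from s.2.2)
  rw [hs] at h1
  have h2 : (l 1).2 = t := le_antisymm (by rw [← Subtype.coe_le_coe, ht]; exact (l 1).2.2.2) h1
  obtain ⟨a, ha, he⟩ : l 1 ∈ x.graph := by rw [← hl.1.2.1]; exact mem_range_self _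
  have h3 : x.GraphLE (l 1) (l s) := by
    rw [hs]
    exact Or.inr ⟨h2, a, ha, 1, by simp, ha.2, he, by rw [h2]; simp⟩
  have h4 : (1 : Icc (0 : ℝ) 1) = s := le_antisymm (hl.le h3) s.2.2
  rw [h4, hs]

/-- The `i`-th point of the partition of `[0, T]` into `N` intervals of equal length. -/
noncomputable def gridPoint (hT : 0 < T) (N i : ℕ) : Icc (0 : ℝ) T := projIcc 0 T hT.le (T * i / N)

theorem gridPoint_mono (hT : 0 < T) (N : ℕ) : Monotone (gridPoint hT N) := fun i j h =>
  monotone_projIcc hT.le (by gcongr)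

theorem gridPoint_zero (hT : 0 < T) (N : ℕ) : (gridPoint hT N 0 : ℝ) = 0 := by
  simp [gridPoint]

theorem gridPoint_self (hT : 0 < T) {N : ℕ} (hN : 0 < N) : (gridPoint hT N N : ℝ) = T := by
  have : (N : ℝ) ≠ 0 := by exact_mod_cast hN.ne'
  simp [gridPoint, this]

theorem gridPoint_succ_sub_le (hT : 0 < T) (N i : ℕ) :
    (gridPoint hT N (i + 1) : ℝ) - gridPoint hT N i ≤ T / N := by
  have h := abs_projIcc_sub_projIcc (c := T * ((i + 1 : ℕ) : ℝ) / N) (d := T * (i : ℝ) / N) hT.le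
  refine (le_abs_self _).trans (h.trans ?_)
  rw [← sub_div, ← mul_sub]
  push_cast
  rw [add_sub_cancel_left, mul_one, abs_of_nonneg (by positivity)]

/-- Paths with small oscillation which are close at the points of a fine partition are close in
the M1 pseudometric. -/
theorem m1Dist_le_of_segOsc (hT : 0 < T) {x y : CadlagPath T X}
    {lx ly : Icc (0 : ℝ) 1 → X × Icc (0 : ℝ) T} (hx : x.IsArc lx) (hy : y.IsArc ly)
    {δ ε : ℝ} (hε : 0 < ε) (hox : SegOsc lx δ ε) (hoy : SegOsc ly δ ε) {N : ℕ} (hN : 0 < N)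
    (hδ : T / N ≤ δ) (hd : ∀ i ≤ N, ‖x (gridPoint hT N i) - y (gridPoint hT N i)‖ ≤ ε) :
    m1Dist (normSeminorm ℝ X) x y ≤ max (9 * ε) δ := by
  have key : ∀ {x : CadlagPath T X} {l : Icc (0 : ℝ) 1 → X × Icc (0 : ℝ) T}, x.IsArc l →
      ∃ s : ℕ → Icc (0 : ℝ) 1, Monotone s ∧ s 0 = 0 ∧ s N = 1 ∧
        ∀ i, l (s i) = (x (gridPoint hT N i), gridPoint hT N i) := by
    intro x l hl
    have : ∀ i, ∃ s, l s = (x (gridPoint hT N i), gridPoint hT N i) := fun i => by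
      change _ ∈ range l
      rw [hl.1.2.1]; exact x.mem_graph _
    choose s hs using this
    refine ⟨s, fun i j hij => hl.le ?_, hl.2 ?_, hl.2 ?_, hs⟩
    · rw [hs, hs]
      -- Beyond index `N` the projection makes all grid points equal to `T`, so coincidences do
      -- occur.
      rcases eq_or_lt_of_le (gridPoint_mono hT N hij) with h | h
      · rw [h]
        exact Or.inr ⟨rfl, 1, by simp, 1, by simp, le_rfl, by simp, by simp⟩
      · exact Or.inl h
    · rw [hs, CadlagPath.arc_zero hl (gridPoint_zero hT N)]
    · rw [hs, CadlagPath.arc_one hl (gridPoint_self hT hN)]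
  obtain ⟨s, hsm, hs0, hs1, hs⟩ := key hx
  obtain ⟨s', hsm', hs0', hs1', hs'⟩ := key hy
  have hδ0 : 0 ≤ δ := le_trans (by positivity) hδ
  -- Cell matchings are concatenated to a monotone path in the parameter square, inside the region
  -- where the curves are close. Its two coordinates are the required reparametrisations.
  have hjoin : ∀ i ≤ N, MonoJoined
      {u | graphDist (normSeminorm ℝ X) (lx u.1) (ly u.2) ≤ max (9 * ε) δ}
      (s 0, s' 0) (s i, s' i) := by
    intro i
    induction i with
    | zero =>
      intro _
      refine MonoJoined.refl ?_
      change graphDist _ (lx (s 0)) (ly (s' 0)) ≤ _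
      rw [hs, hs']
      refine max_le_max ((hd 0 N.zero_le).trans (by linarith)) ?_
      simpa using hδ0
    | succ i ih =>
      intro hi
      refine (ih (by omega)).trans (monoJoined_of_segOsc hx.1.1 hy.1.1 (CadlagPath.monotone_time hx.1)
        (CadlagPath.monotone_time hy.1) hε hox hoy (hsm i.le_succ) (hsm' i.le_succ) ?_ ?_ ?_ ?_ ?_)
      · rw [hs, hs']
      · rw [hs, hs']
      · rw [hs, hs]; exact (gridPoint_succ_sub_le hT N i).trans hδ
      · rw [hs, hs']; exact hd i (by omega)
      · rw [hs, hs']; exact hd (i + 1) hi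
  have hN' := hjoin N le_rfl
  rw [hs0, hs0', hs1, hs1'] at hN'
  obtain ⟨γ, hγ, hR⟩ := hN'
  have hmem : ∀ {α : Icc (0 : ℝ) 1 → Icc (0 : ℝ) 1} {x : CadlagPath T X}
      {l : Icc (0 : ℝ) 1 → X × Icc (0 : ℝ) T}, x.IsArc l → Continuous α → Monotone α → α 0 = 0 →
      α 1 = 1 → l ∘ α ∈ x.paramReps := fun hl hc hm h0 h1 =>
    CadlagPath.comp_mem_paramReps hl.1 hc hm (surjective_of_continuous_zero_one hc h0 h1)
  refine m1Dist_le _ (hmem (α := fun u => (γ u).1) hx (by fun_prop) (fun u v h => (hγ h).1)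
    (by simp) (by simp)) (hmem (α := fun u => (γ u).2) hy (by fun_prop) (fun u v h => (hγ h).2)
    (by simp) (by simp)) hR

end Osc


/-! ### Relative compactness in the M1 topology -/

section Compactness

variable {T : ℝ} {X : Type*} [NormedAddCommGroup X] [NormedSpace ℝ X]

/-- Within the initial time span `δ` the curve `l` stays `ε`-close to its initial value. -/
def StartOsc (l : Icc (0 : ℝ) 1 → X × Icc (0 : ℝ) T) (δ ε : ℝ) : Prop :=
  ∀ s, ((l s).2 : ℝ) ≤ δ → ‖(l s).1 - (l 0).1‖ ≤ ε

theorem SegOsc.mono {l : Icc (0 : ℝ) 1 → X × Icc (0 : ℝ) T} {δ δ' ε : ℝ} (h : SegOsc l δ ε)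
    (hδ : δ' ≤ δ) : SegOsc l δ' ε :=
  fun s₁ s₂ s₃ h1 h2 h3 => h s₁ s₂ s₃ h1 h2 (h3.trans hδ)

theorem isClosed_segment_real (a b : X) : IsClosed (segment ℝ a b) := by
  rw [segment_eq_image']
  exact (isCompact_Icc.image (by fun_prop)).isClosed

/-- A continuous curve whose time component increases from `0` to `T` and whose oscillation
vanishes on small time intervals is a parametric representation of a càdlàg path. -/
theorem exists_mem_paramReps (hT : 0 < T) {l : Icc (0 : ℝ) 1 → X × Icc (0 : ℝ) T}
    (hl : Continuous l) (hm : Monotone fun s => (l s).2) (h0 : ((l 0).2 : ℝ) = 0)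
    (h1 : ((l 1).2 : ℝ) = T) (hseg : ∀ ε > 0, ∃ δ > 0, SegOsc l δ ε)
    (hstart : ∀ ε > 0, ∃ δ > 0, StartOsc l δ ε) : ∃ x : CadlagPath T X, l ∈ x.paramReps := by
  set τ : Icc (0 : ℝ) 1 → Icc (0 : ℝ) T := fun s => (l s).2 with hτ
  set Z : Icc (0 : ℝ) 1 → X := fun s => (l s).1 with hZ
  have hτc : Continuous τ := continuous_snd.comp hl
  have hZc : Continuous Z := continuous_fst.comp hl
  -- At equal times the span is `0`, so the oscillation bound holds for every `ε`, and closedness of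
  -- the segment makes betweenness exact.
  have hbtw : ∀ s₁ s₂ s₃, s₁ ≤ s₂ → s₂ ≤ s₃ → τ s₁ = τ s₃ → Z s₂ ∈ segment ℝ (Z s₁) (Z s₃) := by
    intro s₁ s₂ s₃ h12 h23 hs
    rw [← (isClosed_segment_real (Z s₁) (Z s₃)).closure_eq]
    refine Metric.mem_closure_iff.mpr fun ε hε => ?_
    obtain ⟨δ, hδ, h⟩ := hseg (ε / 2) (by linarith)
    obtain ⟨w, hw, hd⟩ := h s₁ s₂ s₃ h12 h23 (by
      have e : (l s₁).2 = (l s₃).2 := hs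
      rw [e, sub_self]; exact hδ.le)
    exact ⟨w, hw, by rw [dist_eq_norm]; linarith⟩
  -- The convention `x(0-) = x(0)` leaves no room for a jump at time `0`. This is what the condition
  -- on the initial oscillation excludes.
  have hconst : ∀ s, (τ s : ℝ) = 0 → Z s = Z 0 := by
    intro s hs
    rw [← sub_eq_zero, ← norm_le_zero_iff]
    refine le_of_forall_pos_le_add fun ε hε => ?_
    obtain ⟨δ, hδ, h⟩ := hstart ε hε
    rw [zero_add]
    exact h s (by change (τ s : ℝ) ≤ δ; rw [hs]; exact hδ.le)
  have hτs : ∀ t, ∃ s, τ s = t := fun t =>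
    mem_range_of_exists_le_of_exists_ge hτc
      ⟨0, by change ((l 0).2 : ℝ) ≤ t; rw [h0]; exact t.2.1⟩
      ⟨1, by change (t : ℝ) ≤ (l 1).2; rw [h1]; exact t.2.2⟩
  have hlev : ∀ t, IsCompact (τ ⁻¹' {t}) := fun t => (isClosed_singleton.preimage hτc).isCompact
  -- The first and last parameters at time `t` yield the left limit and the value of the path: last
  -- parameters converge to the last one from the right and to the first one from the left.
  have hpex : ∀ t, ∃ s, IsLeast (τ ⁻¹' {t}) s := fun t => (hlev t).exists_isLeast (hτs t)
  have hqex : ∀ t, ∃ s, IsGreatest (τ ⁻¹' {t}) s := fun t => (hlev t).exists_isGreatest (hτs t)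
  choose p hp using hpex
  choose q hq using hqex
  have hτp : ∀ t, τ (p t) = t := fun t => (hp t).1
  have hτq : ∀ t, τ (q t) = t := fun t => (hq t).1
  have hlt : ∀ {s s'}, τ s < τ s' → s < s' := fun h => hm.reflect_lt h
  have hpq : ∀ t, p t ≤ q t := fun t => (hp t).2 (hτq t)
  have hqr : ∀ t, Tendsto q (𝓝[≥] t) (𝓝 (q t)) := fun t => by
    refine tendsto_order.mpr ⟨fun r hr => ?_, fun r hr => ?_⟩
    · filter_upwards [self_mem_nhdsWithin] with t' ht'
      rcases eq_or_lt_of_le (show t ≤ t' from ht') with h | h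
      · rwa [← h]
      · exact hr.trans (hlt (by rwa [hτq, hτq]))
    · have : t < τ r := by
        refine lt_of_le_of_ne ?_ fun h => ?_
        · rw [← hτq t]; exact hm hr.le
        · exact not_le.mpr hr ((hq t).2 h.symm)
      filter_upwards [nhdsWithin_le_nhds (gt_mem_nhds this)] with t' ht'
      exact hlt (by rwa [hτq])
  have hql : ∀ t, Tendsto q (𝓝[<] t) (𝓝 (p t)) := fun t => by
    refine tendsto_order.mpr ⟨fun r hr => ?_, fun r hr => ?_⟩
    · have : τ r < t := by
        refine lt_of_le_of_ne ?_ fun h => ?_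
        · rw [← hτp t]; exact hm hr.le
        · exact not_le.mpr hr ((hp t).2 h)
      filter_upwards [nhdsWithin_le_nhds (lt_mem_nhds this)] with t' ht'
      exact hlt (by rwa [hτq])
    · filter_upwards [self_mem_nhdsWithin] with t' ht'
      refine lt_trans (hlt ?_) hr
      rw [hτq, hτp]; exact ht'
  let x : CadlagPath T X :=
    { toFun := fun t => Z (q t)
      rightCont := fun t => (hZc.tendsto _).comp (hqr t)
      leftLimits := fun t => ⟨Z (p t), (hZc.tendsto _).comp (hql t)⟩ }
  have hleft : ∀ t, Function.leftLim x t = Z (p t) := fun t => by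
    rcases eq_or_lt_of_le t.2.1 with h | h
    · rw [x.leftLim_zero h.symm]
      change Z (q t) = Z (p t)
      rw [hconst (q t) (by rw [hτq, ← h]), hconst (p t) (by rw [hτp, ← h])]
    · have : (𝓝[<] t).NeBot :=
        nhdsLT_neBot_of_exists_lt ⟨(⟨0, le_rfl, hT.le⟩ : Icc (0 : ℝ) T), h⟩
      exact leftLim_eq_of_tendsto ((hZc.tendsto _).comp (hql t))
  have hcomb : ∀ (a : ℝ) (u v : X), u + a • (v - u) = (1 - a) • u + a • v := fun a u v => by module
  have hmem : ∀ s, ∃ a ∈ Icc (0 : ℝ) 1,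
      Z s = Z (p (τ s)) + a • (Z (q (τ s)) - Z (p (τ s))) := fun s => by
    have := hbtw (p (τ s)) s (q (τ s)) ((hp _).2 rfl) ((hq _).2 rfl) (by rw [hτp, hτq])
    rw [segment_eq_image'] at this
    obtain ⟨a, ha, he⟩ := this
    exact ⟨a, ha, he.symm⟩
  refine ⟨x, hl, ?_, ?_⟩
  · ext ⟨z, t⟩
    constructor
    · rintro ⟨s, hs⟩
      obtain ⟨a, ha, he⟩ := hmem s
      have e1 : Z s = z := congrArg Prod.fst hs
      have e2 : τ s = t := congrArg Prod.snd hs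
      refine ⟨a, ha, ?_⟩
      rw [hleft]
      change z = (1 - a) • Z (p t) + a • Z (q t)
      rw [← e1, he, e2, hcomb]
    · rintro ⟨a, ha, he⟩
      rw [hleft] at he
      change z = (1 - a) • Z (p t) + a • Z (q t) at he
      rw [← hcomb] at he
      -- Every point of the jump segment is attained: the intermediate value theorem finds a
      -- parameter at the right distance from `Z (p t)`, and on the segment this distance determines
      -- the point.
      have hgc : Continuous fun u => ‖Z (affineUnit (p t) (q t) u) - Z (p t)‖ :=
        ((hZc.comp (continuous_affineUnit _ _)).sub continuous_const).norm
      obtain ⟨u, hu⟩ : a * ‖Z (q t) - Z (p t)‖ ∈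
          range fun u => ‖Z (affineUnit (p t) (q t) u) - Z (p t)‖ :=
        mem_range_of_exists_le_of_exists_ge hgc
          ⟨0, by rw [affineUnit_zero, sub_self, norm_zero]; exact mul_nonneg ha.1 (norm_nonneg _)⟩
          ⟨1, by rw [affineUnit_one]; exact mul_le_of_le_one_left (norm_nonneg _) ha.2⟩
      set s := affineUnit (p t) (q t) u
      have hps : p t ≤ s := by
        have := monotone_affineUnit (hpq t) (show 0 ≤ u from u.2.1)
        rwa [affineUnit_zero] at this
      have hsq : s ≤ q t := by
        have := monotone_affineUnit (hpq t) (show u ≤ 1 from u.2.2)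
        rwa [affineUnit_one] at this
      have hst : τ s = t := le_antisymm ((hm hsq).trans (hτq t).le) ((hτp t).ge.trans (hm hps))
      refine ⟨s, Prod.ext ?_ hst⟩
      change Z s = z
      obtain ⟨c, hc, hcs⟩ := hmem s
      rw [hst] at hcs
      simp only at hu
      rw [hcs, add_sub_cancel_left, norm_smul, Real.norm_of_nonneg hc.1] at hu
      rw [he, hcs]
      by_cases hD : ‖Z (q t) - Z (p t)‖ = 0
      · rw [norm_eq_zero.mp hD, smul_zero, smul_zero]
      · rw [mul_right_cancel₀ hD hu]
  · intro s s' hs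
    rcases eq_or_lt_of_le (hm hs) with h | h
    · refine Or.inr ⟨h, ?_⟩
      change τ s = τ s' at h
      obtain ⟨b, hb, he⟩ := hmem s'
      have h2 := hbtw (p (τ s)) s s' ((hp _).2 rfl) hs (by rw [hτp, h])
      rw [segment_eq_image'] at h2
      obtain ⟨c, hc, he'⟩ := h2
      -- `Z s` lies on the segment from the left limit to `Z s'`, so its coefficient is a fraction
      -- `c` of the coefficient `b` of `Z s'`.
      refine ⟨c * b, ⟨mul_nonneg hc.1 hb.1, mul_le_one₀ hc.2 hb.1 hb.2⟩, b, hb,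
        mul_le_of_le_one_left hb.1 hc.2, ?_, ?_⟩
      · rw [hleft]
        change Z s = (1 - c * b) • Z (p (τ s)) + (c * b) • Z (q (τ s))
        rw [← hcomb, ← he', he, ← h]
        module
      · rw [hleft]
        change Z s' = (1 - b) • Z (p (τ s)) + b • Z (q (τ s))
        rw [← hcomb, he, h]
    · exact Or.inl h

theorem exists_segment_near {a b a' b' w : X} {r : ℝ} (ha : ‖a - a'‖ ≤ r) (hb : ‖b - b'‖ ≤ r)
    (hw : w ∈ segment ℝ a b) : ∃ w' ∈ segment ℝ a' b', ‖w - w'‖ ≤ r := by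
  obtain ⟨c, d, hc, hd, hcd, rfl⟩ := hw
  refine ⟨c • a' + d • b', ⟨c, d, hc, hd, hcd, rfl⟩, ?_⟩
  have e : c • a + d • b - (c • a' + d • b') = c • (a - a') + d • (b - b') := by module
  rw [e]
  refine (norm_add_le _ _).trans ?_
  rw [norm_smul, norm_smul, Real.norm_of_nonneg hc, Real.norm_of_nonneg hd]
  calc c * ‖a - a'‖ + d * ‖b - b'‖ ≤ c * r + d * r := by gcongr
    _ = r := by rw [← add_mul, hcd, one_mul]

/-- Both outer times may shift by `r`, which costs `2 * r` in the span. The middle point and the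
segment each move by at most `r`, which costs `2 * r` in the error. -/
theorem SegOsc.of_dist_le {l l' : Icc (0 : ℝ) 1 → X × Icc (0 : ℝ) T} {δ ε r : ℝ}
    (h : SegOsc l (δ + 2 * r) ε) (hd : ∀ s, dist (l s) (l' s) ≤ r) :
    SegOsc l' δ (ε + 2 * r) := by
  intro s₁ s₂ s₃ h12 h23 ht
  have hz : ∀ s, ‖(l s).1 - (l' s).1‖ ≤ r := fun s => by
    rw [← dist_eq_norm]; exact (le_max_left _ _).trans (hd s)
  have hτ : ∀ s, |((l s).2 : ℝ) - (l' s).2| ≤ r := fun s => (le_max_right _ _).trans (hd s)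
  obtain ⟨w, hw, hw'⟩ := h s₁ s₂ s₃ h12 h23 (by
    have e1 := abs_le.mp (hτ s₁); have e3 := abs_le.mp (hτ s₃)
    linarith [e1.1, e3.2])
  obtain ⟨w', hw1, hw2⟩ := exists_segment_near (hz s₁) (hz s₃) hw
  refine ⟨w', hw1, ?_⟩
  have e : (l' s₂).1 - w' = -((l s₂).1 - (l' s₂).1) + ((l s₂).1 - w) + (w - w') := by abel
  rw [e]
  refine (norm_add₃_le).trans ?_
  rw [norm_neg]
  linarith [hz s₂]

theorem StartOsc.of_dist_le {l l' : Icc (0 : ℝ) 1 → X × Icc (0 : ℝ) T} {δ ε r : ℝ}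
    (h : StartOsc l (δ + r) ε) (hd : ∀ s, dist (l s) (l' s) ≤ r) :
    StartOsc l' δ (ε + 2 * r) := by
  intro s ht
  have hz : ∀ s, ‖(l s).1 - (l' s).1‖ ≤ r := fun s => by
    rw [← dist_eq_norm]; exact (le_max_left _ _).trans (hd s)
  have hτ : |((l s).2 : ℝ) - (l' s).2| ≤ r := (le_max_right _ _).trans (hd s)
  have h1 := h s (by linarith [(abs_le.mp hτ).2])
  have e : (l' s).1 - (l' 0).1 = -((l s).1 - (l' s).1) + ((l s).1 - (l 0).1) +
    ((l 0).1 - (l' 0).1) := by abel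
  rw [e]
  refine (norm_add₃_le).trans ?_
  rw [norm_neg]
  linarith [hz s, hz 0]

variable {A : Set (CadlagPath T X)}

/-- Composing the successive order isomorphisms aligns all arcs, which then converge uniformly. The
limit curve inherits the oscillation bounds and so represents a càdlàg path. It need not be
injective, so it is only claimed to be a parametric representation. -/
theorem exists_tendsto_of_cauchySeq [CompleteSpace X] (hT : 0 < T)
    (hosc : ∀ ε > 0, ∃ δ > 0, ∀ x ∈ A, ∀ l, x.IsArc l → SegOsc l δ ε ∧ StartOsc l δ ε)
    {v : ℕ → CadlagPath T X} (hv : ∀ n, v n ∈ A)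
    (hd : ∀ n, m1Dist (normSeminorm ℝ X) (v n) (v (n + 1)) < (1 / 2) ^ n) :
    ∃ x, Tendsto (fun n => m1Dist (normSeminorm ℝ X) (v n) x) atTop (𝓝 0) := by
  choose l hl using fun n => (v n).exists_isArc hT
  have hψ := fun n => exists_orderIso_of_m1Dist_lt (by exact continuous_norm) (hl n) (hl (n + 1))
    (hd n)
  choose ψ hψ using hψ
  let Ψ : ℕ → (Icc (0 : ℝ) 1 ≃o Icc (0 : ℝ) 1) := fun n =>
    Nat.rec (OrderIso.refl _) (fun n φ => φ.trans (ψ n)) n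
  have harc : ∀ n, (v n).IsArc (l n ∘ Ψ n) := fun n => (hl n).comp (Ψ n)
  let L : ℕ → C(Icc (0 : ℝ) 1, X × Icc (0 : ℝ) T) := fun n => ⟨l n ∘ Ψ n, (harc n).1.1⟩
  have hLd : ∀ n, dist (L n) (L (n + 1)) ≤ 1 * (1 / 2) ^ n := fun n => by
    rw [one_mul]
    refine (ContinuousMap.dist_le (by positivity)).mpr fun s => ?_
    rw [← graphDist_norm_eq_dist]
    exact (hψ n (Ψ n s)).le
  obtain ⟨L', hL'⟩ := cauchySeq_tendsto_of_complete
    (cauchySeq_of_le_geometric (1 / 2) 1 (by norm_num) hLd)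
  have hev : ∀ s, Tendsto (fun n => L n s) atTop (𝓝 (L' s)) := fun s =>
    ((continuous_eval_const (F := C(Icc (0 : ℝ) 1, X × Icc (0 : ℝ) T)) s).tendsto L').comp hL'
  have hevt : ∀ s, Tendsto (fun n => (L n s).2) atTop (𝓝 (L' s).2) := fun s =>
    (continuous_snd.tendsto _).comp (hev s)
  have hnear : ∀ r > 0, ∃ n, ∀ s, dist (L n s) (L' s) ≤ r := fun r hr => by
    obtain ⟨n, hn⟩ := (Metric.tendsto_atTop.mp hL' r hr)
    exact ⟨n, fun s => (ContinuousMap.dist_apply_le_dist s).trans (hn n le_rfl).le⟩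
  obtain ⟨x, hx⟩ := exists_mem_paramReps hT L'.continuous
    (fun s s' hs => le_of_tendsto_of_tendsto' (hevt s) (hevt s') fun n =>
      CadlagPath.monotone_time (harc n).1 hs)
    (by
      have h : ∀ n, (L n 0).2 = ⟨0, le_rfl, hT.le⟩ := fun n =>
        congrArg Prod.snd (CadlagPath.arc_zero (harc n) (t := ⟨0, le_rfl, hT.le⟩) rfl)
      have := hevt 0
      simp_rw [h] at this
      rw [← tendsto_nhds_unique tendsto_const_nhds this])
    (by
      have h : ∀ n, (L n 1).2 = ⟨T, hT.le, le_rfl⟩ := fun n =>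
        congrArg Prod.snd (CadlagPath.arc_one (harc n) (t := ⟨T, hT.le, le_rfl⟩) rfl)
      have := hevt 1
      simp_rw [h] at this
      rw [← tendsto_nhds_unique tendsto_const_nhds this])
    (fun ε hε => by
      obtain ⟨δ, hδ, h⟩ := hosc (ε / 3) (by linarith)
      obtain ⟨n, hn⟩ := hnear (min (ε / 3) (δ / 4)) (lt_min (by linarith) (by linarith))
      have m1 := min_le_left (ε / 3) (δ / 4)
      have m2 := min_le_right (ε / 3) (δ / 4)
      refine ⟨δ / 2, by linarith, fun s₁ s₂ s₃ h12 h23 ht => ?_⟩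
      obtain ⟨w, hw, hw'⟩ := SegOsc.of_dist_le
        (((h _ (hv n) _ (harc n)).1).mono (by linarith)) hn s₁ s₂ s₃ h12 h23 ht
      exact ⟨w, hw, by linarith⟩)
    (fun ε hε => by
      obtain ⟨δ, hδ, h⟩ := hosc (ε / 3) (by linarith)
      obtain ⟨n, hn⟩ := hnear (min (ε / 3) (δ / 4)) (lt_min (by linarith) (by linarith))
      have m1 := min_le_left (ε / 3) (δ / 4)
      have m2 := min_le_right (ε / 3) (δ / 4)
      refine ⟨δ / 2, by linarith, fun s ht => ?_⟩
      have h1 : StartOsc (L n) (δ / 2 + min (ε / 3) (δ / 4)) (ε / 3) := fun s hs =>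
        (h _ (hv n) _ (harc n)).2 s (hs.trans (by linarith))
      have := h1.of_dist_le hn s ht
      linarith)
  refine ⟨x, squeeze_zero (fun n => m1Dist_nonneg _ _ _) (fun n => ?_)
    (tendsto_iff_dist_tendsto_zero.mp hL')⟩
  refine m1Dist_le _ (harc n).1 hx fun s => ?_
  rw [graphDist_norm_eq_dist]
  exact ContinuousMap.dist_apply_le_dist (f := L n) (g := L') s

/-- A sufficient condition for relative compactness in the M1 topology: the paths take values in a
compact set, and their oscillations vanish uniformly on small time intervals. -/
theorem isRelCompactIn_m1TopologyNormed [CompleteSpace X] (hT : 0 < T) {K : Set X}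
    (hK : IsCompact K) (hAK : ∀ x ∈ A, ∀ t, x t ∈ K)
    (hosc : ∀ ε > 0, ∃ δ > 0, ∀ x ∈ A, ∀ l, x.IsArc l → SegOsc l δ ε ∧ StartOsc l δ ε) :
    IsRelCompactIn (m1TopologyNormed T X) A := by
  unfold IsRelCompactIn
  rw [m1TopologyNormed_eq hT]
  let := m1PseudoMetricSpace hT X
  refine IsSeqCompact.isCompact fun w hw => ?_
  have hu : ∀ n, ∃ u ∈ A, dist (w n) u < 1 / ((n : ℝ) + 1) := fun n =>
    Metric.mem_closure_iff.mp (hw n) _ (by positivity)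
  choose u huA hwu using hu
  suffices H : ∃ x, ∃ φ : ℕ → ℕ, StrictMono φ ∧ Tendsto (u ∘ φ) atTop (𝓝 x) by
    obtain ⟨x, φ, hφ, hx⟩ := H
    have hwx : Tendsto (w ∘ φ) atTop (𝓝 x) := by
      rw [tendsto_iff_dist_tendsto_zero] at hx ⊢
      have h1 : Tendsto (fun n => 1 / ((φ n : ℝ) + 1)) atTop (𝓝 0) :=
        tendsto_one_div_add_atTop_nhds_zero_nat.comp hφ.tendsto_atTop
      have h2 := h1.add hx
      rw [add_zero] at h2
      refine squeeze_zero (fun _ => dist_nonneg) (fun n => ?_) h2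
      exact (dist_triangle _ (u (φ n)) _).trans (add_le_add (hwu _).le le_rfl)
    exact ⟨x, isClosed_closure.mem_of_tendsto hwx (Eventually.of_forall fun n => hw _), φ, hφ, hwx⟩
  -- The values on all grids form a point of a countable power of `K`, so one subsequence converges
  -- on every grid simultaneously.
  let V : ℕ → ℕ × ℕ → X := fun n j => u n (gridPoint hT j.1 j.2)
  obtain ⟨V', -, φ, hφ, hV⟩ := (isCompact_univ_pi fun _ : ℕ × ℕ => hK).tendsto_subseq
    (x := V) fun n => mem_univ_pi.mpr fun j => hAK _ (huA n) _
  rw [tendsto_pi_nhds] at hV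
  have hcau : CauchySeq (u ∘ φ) := by
    refine Metric.cauchySeq_iff.mpr fun ε hε => ?_
    -- The matching error is nine times `ε / 18`, that is `ε / 2`. Two paths within `ε / 36` of the
    -- limiting grid values are within `ε / 18` of each other.
    obtain ⟨δ, hδ, h⟩ := hosc (ε / 18) (by linarith)
    set δ' := min δ (ε / 2) with hδ'
    have hδ0 : 0 < δ' := lt_min hδ (by linarith)
    obtain ⟨N, hN⟩ := exists_nat_gt (T / δ')
    have hN0 : (0 : ℝ) < N := lt_trans (by positivity) hN
    have hTN : T / N ≤ δ' := by
      rw [div_lt_iff₀ hδ0] at hN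
      rw [div_le_iff₀ hN0]; linarith
    have hfin : ∀ᶠ n in atTop, ∀ i ∈ Finset.range (N + 1),
        dist (V (φ n) (N, i)) (V' (N, i)) < ε / 36 := by
      rw [Finset.eventually_all]
      intro i _
      exact (Metric.tendsto_nhds.mp (hV (N, i))) _ (by linarith)
    obtain ⟨M, hM⟩ := eventually_atTop.mp hfin
    refine ⟨M, fun m hm n hn => ?_⟩
    obtain ⟨lm, hlm⟩ := (u (φ m)).exists_isArc hT
    obtain ⟨ln, hln⟩ := (u (φ n)).exists_isArc hT
    have := m1Dist_le_of_segOsc hT hlm hln (show 0 < ε / 18 by linarith)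
      ((h _ (huA _) _ hlm).1.mono (min_le_left _ _)) ((h _ (huA _) _ hln).1.mono (min_le_left _ _))
      (by exact_mod_cast hN0) hTN (fun i hi => by
        have e1 := hM m hm i (Finset.mem_range.mpr (by omega))
        have e2 := hM n hn i (Finset.mem_range.mpr (by omega))
        rw [← dist_eq_norm]
        exact (dist_triangle_right _ _ (V' (N, i))).trans (by linarith))
    refine lt_of_le_of_lt this (max_lt (by linarith) ?_)
    exact (min_le_right _ _).trans_lt (by linarith)
  obtain ⟨χ, hχ, hsub⟩ := hcau.subseq_mem
    (V := fun n => {p | dist p.1 p.2 < (1 / 2 : ℝ) ^ n})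
    (fun n => Metric.dist_mem_uniformity (by positivity))
  obtain ⟨x, hx⟩ := exists_tendsto_of_cauchySeq hT hosc (v := fun n => u (φ (χ n)))
    (fun n => huA _) (fun n => by
      have := hsub n
      rw [m1Dist_comm]
      exact this)
  exact ⟨x, φ ∘ χ, hφ.comp hχ, tendsto_iff_dist_tendsto_zero.mpr hx⟩

end Compactness


/-! ### Uniform moduli of relatively compact sets of real paths -/

section RealModulus

variable {T : ℝ}

/-- For any three successive points of the real curve `l` within a time span `δ`, the middle value
exceeds the larger one of the other values by at most `ε`. -/
def UpperOsc (l : Icc (0 : ℝ) 1 → ℝ × Icc (0 : ℝ) T) (δ ε : ℝ) : Prop :=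
  ∀ s₁ s₂ s₃, s₁ ≤ s₂ → s₂ ≤ s₃ → ((l s₃).2 : ℝ) - (l s₁).2 ≤ δ →
    (l s₂).1 ≤ max (l s₁).1 (l s₃).1 + ε

theorem UpperOsc.mono {l : Icc (0 : ℝ) 1 → ℝ × Icc (0 : ℝ) T} {δ δ' ε : ℝ} (h : UpperOsc l δ ε)
    (hδ : δ' ≤ δ) : UpperOsc l δ' ε :=
  fun s₁ s₂ s₃ h1 h2 h3 => h s₁ s₂ s₃ h1 h2 (h3.trans hδ)

theorem UpperOsc.comp {l : Icc (0 : ℝ) 1 → ℝ × Icc (0 : ℝ) T} {δ ε : ℝ} (h : UpperOsc l δ ε)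
    {f : Icc (0 : ℝ) 1 → Icc (0 : ℝ) 1} (hf : Monotone f) : UpperOsc (l ∘ f) δ ε :=
  fun _ _ _ h1 h2 h3 => h _ _ _ (hf h1) (hf h2) h3

theorem StartOsc.mono {X : Type*} [NormedAddCommGroup X]
    {l : Icc (0 : ℝ) 1 → X × Icc (0 : ℝ) T} {δ δ' ε : ℝ} (h : StartOsc l δ ε)
    (hδ : δ' ≤ δ) : StartOsc l δ' ε :=
  fun s h1 => h s (h1.trans hδ)

theorem StartOsc.comp {X : Type*} [NormedAddCommGroup X]
    {l : Icc (0 : ℝ) 1 → X × Icc (0 : ℝ) T} {δ ε : ℝ} (h : StartOsc l δ ε)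
    {f : Icc (0 : ℝ) 1 → Icc (0 : ℝ) 1} (h0 : f 0 = 0) : StartOsc (l ∘ f) δ ε := fun s hs => by
  have := h (f s) hs
  rwa [← h0] at this

theorem UpperOsc.of_dist_le {l l' : Icc (0 : ℝ) 1 → ℝ × Icc (0 : ℝ) T} {δ ε r : ℝ}
    (h : UpperOsc l (δ + 2 * r) ε) (hd : ∀ s, dist (l s) (l' s) ≤ r) :
    UpperOsc l' δ (ε + 2 * r) := by
  intro s₁ s₂ s₃ h12 h23 ht
  have hz : ∀ s, |(l s).1 - (l' s).1| ≤ r := fun s => (le_max_left _ _).trans (hd s)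
  have hτ : ∀ s, |((l s).2 : ℝ) - (l' s).2| ≤ r := fun s => (le_max_right _ _).trans (hd s)
  have e1 := abs_le.mp (hτ s₁)
  have e3 := abs_le.mp (hτ s₃)
  have z1 := abs_le.mp (hz s₁)
  have z2 := abs_le.mp (hz s₂)
  have z3 := abs_le.mp (hz s₃)
  have h1 := h s₁ s₂ s₃ h12 h23 (by linarith [e1.1, e3.2])
  have h2 : max (l s₁).1 (l s₃).1 ≤ max (l' s₁).1 (l' s₃).1 + r :=
    max_le (by linarith [le_max_left (l' s₁).1 (l' s₃).1, z1.2])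
      (by linarith [le_max_right (l' s₁).1 (l' s₃).1, z3.2])
  linarith [z2.1]

/-- On the compact part of `K` where `F` is at least `ε`, the function `G` attains a positive
minimum, and half of it serves as `δ`. -/
theorem IsCompact.exists_pos_forall_lt {α : Type*} [TopologicalSpace α] {K : Set α}
    (hK : IsCompact K) {F G : α → ℝ} (hF : Continuous F) (hG : Continuous G) {ε : ℝ}
    (h : ∀ k ∈ K, G k ≤ 0 → F k < ε) : ∃ δ > 0, ∀ k ∈ K, G k ≤ δ → F k < ε := by
  have hbad : IsCompact (K ∩ {k | ε ≤ F k}) :=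
    hK.inter_right (isClosed_le continuous_const hF)
  rcases (K ∩ {k | ε ≤ F k}).eq_empty_or_nonempty with he | hne
  · refine ⟨1, one_pos, fun k hk _ => ?_⟩
    by_contra hc
    have : k ∈ K ∩ {k | ε ≤ F k} := ⟨hk, not_lt.mp hc⟩
    rw [he] at this
    exact this
  · obtain ⟨k₀, hk₀, hmin⟩ := hbad.exists_isMinOn hne hG.continuousOn
    have hpos : 0 < G k₀ := by
      by_contra hc
      exact absurd hk₀.2 (not_le.mpr (h k₀ hk₀.1 (not_lt.mp hc)))
    refine ⟨G k₀ / 2, by linarith, fun k hk hGk => ?_⟩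
    by_contra hc
    have h1 : G k₀ ≤ G k := hmin (show k ∈ K ∩ {k | ε ≤ F k} from ⟨hk, not_lt.mp hc⟩)
    linarith

/-- The three points share one time, where a real curve runs monotonically along its jump. For an
upward jump the third value dominates the middle one, for a downward jump the first. -/
theorem CadlagPath.le_max_of_paramReps {x : CadlagPath T ℝ}
    {l : Icc (0 : ℝ) 1 → ℝ × Icc (0 : ℝ) T} (hl : l ∈ x.paramReps) {s₁ s₂ s₃ : Icc (0 : ℝ) 1}
    (h12 : s₁ ≤ s₂) (h23 : s₂ ≤ s₃) (ht : (l s₃).2 ≤ (l s₁).2) :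
    (l s₂).1 ≤ max (l s₁).1 (l s₃).1 := by
  have t12 : (l s₁).2 ≤ (l s₂).2 := monotone_time hl h12
  have t23 : (l s₂).2 ≤ (l s₃).2 := monotone_time hl h23
  have e12 : (l s₁).2 = (l s₂).2 := le_antisymm t12 (t23.trans ht)
  have e23 : (l s₂).2 = (l s₃).2 := le_antisymm t23 (ht.trans t12)
  rcases hl.2.2 _ _ h12 with h | ⟨-, a₁, ha₁, a₂, ha₂, ha, z₁, z₂⟩
  · exact absurd h (by rw [e12]; exact lt_irrefl _)
  rcases hl.2.2 _ _ h23 with h | ⟨-, b₂, hb₂, b₃, hb₃, hb, z₂', z₃⟩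
  · exact absurd h (by rw [e23]; exact lt_irrefl _)
  rw [← e12] at z₂' z₃
  set f := Function.leftLim x (l s₁).2
  set g := x (l s₁).2
  simp only [smul_eq_mul] at z₁ z₂ z₂' z₃
  rcases le_total f g with hfg | hfg
  · refine le_trans ?_ (le_max_right _ _)
    rw [z₂', z₃]; nlinarith
  · refine le_trans ?_ (le_max_left _ _)
    rw [z₂, z₁]; nlinarith

/-- On the compact set of ordered triples of parameters, zero time span means zero excess, so by
compactness a small span means a small excess. -/
theorem CadlagPath.exists_upperOsc {x : CadlagPath T ℝ}
    {l : Icc (0 : ℝ) 1 → ℝ × Icc (0 : ℝ) T} (hl : l ∈ x.paramReps) {ε : ℝ} (hε : 0 < ε) :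
    ∃ δ > 0, UpperOsc l δ ε := by
  have hc1 : Continuous fun s => (l s).1 := continuous_fst.comp hl.1
  have hc2 : Continuous fun s => ((l s).2 : ℝ) :=
    continuous_subtype_val.comp (continuous_snd.comp hl.1)
  let K : Set (Icc (0 : ℝ) 1 × Icc (0 : ℝ) 1 × Icc (0 : ℝ) 1) := {k | k.1 ≤ k.2.1 ∧ k.2.1 ≤ k.2.2}
  have hK : IsCompact K := IsClosed.isCompact
    ((isClosed_le (by fun_prop) (by fun_prop)).inter (isClosed_le (by fun_prop) (by fun_prop)))
  obtain ⟨δ, hδ, h⟩ := hK.exists_pos_forall_lt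
    (F := fun k => (l k.2.1).1 - max (l k.1).1 (l k.2.2).1)
    (G := fun k => ((l k.2.2).2 : ℝ) - (l k.1).2) (ε := ε)
    ((hc1.comp (by fun_prop : Continuous fun k : Icc (0 : ℝ) 1 × Icc (0 : ℝ) 1 × Icc (0 : ℝ) 1 =>
      k.2.1)).sub ((hc1.comp continuous_fst).max (hc1.comp (continuous_snd.comp continuous_snd))))
    ((hc2.comp (continuous_snd.comp continuous_snd)).sub (hc2.comp continuous_fst))
    (fun k hk hG => by
      have := le_max_of_paramReps hl hk.1 hk.2 (Subtype.coe_le_coe.mp (by linarith))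
      linarith)
  exact ⟨δ, hδ, fun s₁ s₂ s₃ h1 h2 h3 => by linarith [h (s₁, s₂, s₃) ⟨h1, h2⟩ h3]⟩

theorem CadlagPath.exists_startOsc {X : Type*} [NormedAddCommGroup X] [NormedSpace ℝ X]
    {x : CadlagPath T X} {l : Icc (0 : ℝ) 1 → X × Icc (0 : ℝ) T} (hl : x.IsArc l) {ε : ℝ}
    (hε : 0 < ε) : ∃ δ > 0, StartOsc l δ ε := by
  have hc1 : Continuous fun s => (l s).1 := continuous_fst.comp hl.1.1
  have hc2 : Continuous fun s => ((l s).2 : ℝ) :=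
    continuous_subtype_val.comp (continuous_snd.comp hl.1.1)
  obtain ⟨δ, hδ, h⟩ := (isCompact_univ (X := Icc (0 : ℝ) 1)).exists_pos_forall_lt
    (F := fun s => ‖(l s).1 - (l 0).1‖) (G := fun s => ((l s).2 : ℝ)) (ε := ε)
    (hc1.sub continuous_const).norm hc2
    (fun s _ hG => by
      have ht : ((l s).2 : ℝ) = 0 := le_antisymm hG (l s).2.2.1
      obtain ⟨a, -, he⟩ : l s ∈ x.graph := by rw [← hl.1.2.1]; exact mem_range_self _
      rw [x.leftLim_zero ht, ← add_smul, sub_add_cancel, one_smul] at he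
      rw [arc_zero hl ht, he, sub_self, norm_zero]
      exact hε)
  exact ⟨δ, hδ, fun s hs => (h s (mem_univ s) hs).le⟩

/-- A property that holds locally with some `δ`, and persists for smaller `δ`, holds with one `δ` on
a compact closure, by finite covers. -/
theorem IsRelCompactIn.exists_uniform {X : Type*} [NormedAddCommGroup X] [NormedSpace ℝ X]
    (hT : 0 < T) {A : Set (CadlagPath T X)} (hA : IsRelCompactIn (m1TopologyNormed T X) A)
    {P : CadlagPath T X → ℝ → Prop} (hP : ∀ y δ δ', 0 < δ' → δ' ≤ δ → P y δ → P y δ')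
    (hloc : ∀ x, ∃ η > 0, ∃ δ > 0, ∀ y, m1Dist (normSeminorm ℝ X) y x < η → P y δ) :
    ∃ δ > 0, ∀ y ∈ A, P y δ := by
  unfold IsRelCompactIn at hA
  rw [m1TopologyNormed_eq hT] at hA
  let := m1PseudoMetricSpace hT X
  suffices H : ∃ δ > 0, ∀ y ∈ closure A, P y δ by
    obtain ⟨δ, hδ, h⟩ := H
    exact ⟨δ, hδ, fun y hy => h y (subset_closure hy)⟩
  refine hA.induction_on (p := fun S => ∃ δ > 0, ∀ y ∈ S, P y δ) ⟨1, one_pos, by simp⟩ ?_ ?_ ?_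
  · rintro S S' hS ⟨δ, hδ, h⟩
    exact ⟨δ, hδ, fun y hy => h y (hS hy)⟩
  · rintro S S' ⟨δ, hδ, h⟩ ⟨δ', hδ', h'⟩
    refine ⟨min δ δ', lt_min hδ hδ', fun y hy => ?_⟩
    rcases hy with hy | hy
    · exact hP _ _ _ (lt_min hδ hδ') (min_le_left _ _) (h y hy)
    · exact hP _ _ _ (lt_min hδ hδ') (min_le_right _ _) (h' y hy)
  · intro x _
    obtain ⟨η, hη, δ, hδ, h⟩ := hloc x
    exact ⟨Metric.ball x η, mem_nhdsWithin_of_mem_nhds (Metric.ball_mem_nhds x hη), δ, hδ,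
      fun y hy => h y hy⟩

theorem IsRelCompactIn.exists_upperOsc (hT : 0 < T) {A : Set (CadlagPath T ℝ)}
    (hA : IsRelCompactIn (m1TopologyNormed T ℝ) A) {ε : ℝ} (hε : 0 < ε) :
    ∃ δ > 0, ∀ y ∈ A, ∀ l ∈ y.paramReps, UpperOsc l δ ε ∧ StartOsc l δ ε := by
  refine hA.exists_uniform hT
    (P := fun y δ => ∀ l ∈ y.paramReps, UpperOsc l δ ε ∧ StartOsc l δ ε)
    (fun y δ δ' _ h1 h2 l hl => ⟨(h2 l hl).1.mono h1, (h2 l hl).2.mono h1⟩) fun x => ?_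
  obtain ⟨lx, hx⟩ := x.exists_isArc hT
  obtain ⟨δ₁, hδ₁, h₁⟩ := CadlagPath.exists_upperOsc hx.1 (show 0 < ε / 3 by linarith)
  obtain ⟨δ₂, hδ₂, h₂⟩ := CadlagPath.exists_startOsc hx (show 0 < ε / 3 by linarith)
  set δ := min δ₁ δ₂
  have hδ : 0 < δ := lt_min hδ₁ hδ₂
  -- Transferring the modulus from `x` to a path within `η` costs `2 * η` in both arguments. These
  -- choices give `ε / 3 + 2 * η ≤ ε` and `δ / 2 + 2 * η ≤ δ`.
  set η := min (ε / 3) (δ / 4)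
  have e1 : η ≤ ε / 3 := min_le_left _ _
  have e2 : η ≤ δ / 4 := min_le_right _ _
  have e3 : δ ≤ δ₁ := min_le_left _ _
  have e4 : δ ≤ δ₂ := min_le_right _ _
  refine ⟨η, lt_min (by linarith) (by linarith), δ / 2, by linarith, fun y hy l hl => ?_⟩
  obtain ⟨ly, hly⟩ := y.exists_isArc hT
  obtain ⟨ψ, hψ⟩ := exists_orderIso_of_m1Dist_lt (q := normSeminorm ℝ ℝ)
    (by exact continuous_norm) hx hly (by rw [m1Dist_comm]; exact hy)
  obtain ⟨f, -, fm, fs, rfl⟩ := hly.factor hl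
  have hd : ∀ s, dist ((lx ∘ ψ.symm) s) (ly s) ≤ η := fun s => by
    have := hψ (ψ.symm s)
    rw [OrderIso.apply_symm_apply, graphDist_norm_eq_dist] at this
    exact this.le
  have hu := ((h₁.comp ψ.symm.monotone).mono
    (show δ / 2 + 2 * η ≤ δ₁ by linarith)).of_dist_le hd
  have hs := ((h₂.comp (f := ψ.symm) ψ.symm.map_bot).mono
    (show δ / 2 + η ≤ δ₂ by linarith)).of_dist_le hd
  refine ⟨UpperOsc.comp (fun s₁ s₂ s₃ h12 h23 ht => ?_) fm,
    StartOsc.comp (fun s ht => ?_) (monotone_surjective_zero fm fs)⟩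
  · linarith [hu s₁ s₂ s₃ h12 h23 ht]
  · linarith [hs s ht]

theorem CadlagPath.exists_bound_of_m1Dist_lt {X : Type*} [NormedAddCommGroup X] [NormedSpace ℝ X]
    (hT : 0 < T) (x : CadlagPath T X) :
    ∃ M > 0, ∀ y : CadlagPath T X, m1Dist (normSeminorm ℝ X) y x < 1 → ∀ t, ‖y t‖ ≤ M := by
  obtain ⟨lx, hx⟩ := x.exists_isArc hT
  obtain ⟨M, hM⟩ := (isCompact_range (continuous_fst.comp hx.1.1)).isBounded.exists_norm_le
  have hM' : ∀ s, ‖(lx s).1‖ ≤ M := fun s => hM _ (mem_range_self s)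
  have hM0 : 0 ≤ M := (norm_nonneg _).trans (hM' 0)
  refine ⟨M + 1, by linarith, fun y hy t => ?_⟩
  obtain ⟨ly, hly⟩ := y.exists_isArc hT
  obtain ⟨ψ, hψ⟩ := exists_orderIso_of_m1Dist_lt (by exact continuous_norm) hly hx hy
  obtain ⟨s, hs⟩ : (y t, t) ∈ range ly := by rw [hly.1.2.1]; exact y.mem_graph t
  have h1 : ‖(ly s).1 - (lx (ψ s)).1‖ < 1 := (le_max_left _ _).trans_lt (hψ s)
  rw [hs] at h1
  have h2 := norm_sub_norm_le (y t) (lx (ψ s)).1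
  linarith [hM' (ψ s)]

theorem IsRelCompactIn.exists_bound {X : Type*} [NormedAddCommGroup X] [NormedSpace ℝ X]
    (hT : 0 < T) {A : Set (CadlagPath T X)} (hA : IsRelCompactIn (m1TopologyNormed T X) A) :
    ∃ M, ∀ y ∈ A, ∀ t, ‖y t‖ ≤ M := by
  -- The bound is encoded as `1 / δ`, so that it weakens as `δ` decreases.
  obtain ⟨δ, -, h⟩ := hA.exists_uniform hT (P := fun y δ => ∀ t, ‖y t‖ ≤ 1 / δ)
    (fun y δ δ' h0 h1 h2 t => (h2 t).trans (one_div_le_one_div_of_le h0 h1)) fun x => by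
      obtain ⟨M, hM, h⟩ := x.exists_bound_of_m1Dist_lt hT
      exact ⟨1, one_pos, 1 / M, by positivity, fun y hy t => by rw [one_div_one_div]; exact h y hy t⟩
  exact ⟨1 / δ, h⟩

end RealModulus


/-! ### Nuclearity -/

section Nuclear

variable {E : Type*} [AddCommGroup E] [Module ℝ E]

/-- If the `p`-orthonormal systems are square summable for `q ≤ p`, then the unit ball of `p` is
totally bounded for `q`. -/
theorem Seminorm.exists_finite_net {p q : Seminorm ℝ E} (hp : p.IsHilbertian) (hqp : q ≤ p)
    (hs : ∀ S : Set E, p.IsOrthonormalSet S → Summable fun e : S => q (e : E) ^ 2)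
    {ε : ℝ} (hε : 0 < ε) :
    ∃ F : Set E, F.Finite ∧ ∀ φ, p φ ≤ 1 → ∃ ψ ∈ F, q (φ - ψ) ≤ ε := by
  classical
  obtain ⟨B, hBs, hB⟩ := hp
  have hpol : ∀ x y, p.polarInner x y = B x y := p.polarInner_eq B hBs hB
  set c := ε / 2 with hc
  have hc0 : 0 < c := by linarith
  -- A maximal orthonormal system of vectors that are large for `q`. Square summability makes it
  -- finite, and maximality makes `q` small on the part of the unit ball orthogonal to it.
  obtain ⟨S, hS⟩ := zorn_subset {S : Set E | p.IsOrthonormalSet S ∧ ∀ e ∈ S, c ≤ q e}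
    (fun C hC hch => by
      refine ⟨⋃₀ C, ⟨⟨?_, ?_⟩, ?_⟩, fun s hs => subset_sUnion_of_mem hs⟩
      · rintro e ⟨s, hs, he⟩
        exact (hC hs).1.1 e he
      · exact (pairwise_sUnion hch.directedOn).mpr fun s hs => (hC hs).1.2
      · rintro e ⟨s, hs, he⟩
        exact (hC hs).2 e he)
  obtain ⟨⟨hSo, hSc⟩, hmax⟩ := hS
  have hfin : Finite S := by
    have h1 := (hs S hSo).tendsto_cofinite_zero.eventually (gt_mem_nhds (show 0 < c ^ 2 by positivity))
    have h2 : {e : S | ¬ q (e : E) ^ 2 < c ^ 2} = univ := eq_univ_of_forall fun e =>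
      not_lt.mpr (pow_le_pow_left₀ hc0.le (hSc e e.2) 2)
    rw [eventually_cofinite, h2] at h1
    exact finite_univ_iff.mp h1
  have : Fintype S := Fintype.ofFinite S
  let Lv : SeminormedAddCommGroup E := q.toAddGroupSeminorm.toSeminormedAddCommGroup
  let Ls : NormedSpace ℝ E :=
    { norm_smul_le := fun a x => (map_smul_eq_mul q a x).le }
  let Φ : (S → ℝ) → E := fun a => ∑ e : S, a e • (e : E)
  have hΦ : Continuous Φ := by fun_prop
  have hcomp := (isCompact_closedBall (0 : S → ℝ) 1).image hΦ
  obtain ⟨F, -, hF, hcov⟩ := hcomp.finite_cover_balls hc0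
  refine ⟨F, hF, fun φ hφ => ?_⟩
  have hBφ : B φ φ ≤ 1 := by
    rw [hB]; exact pow_le_one₀ (apply_nonneg p φ) hφ
  set P := Φ fun e => B e φ with hP
  set v := φ - P with hv
  have hon : ∀ e f : S, B e f = if e = f then 1 else 0 := fun e f => by
    split_ifs with h
    · rw [h, hB, hSo.1 f f.2, one_pow]
    · rw [← hpol]
      exact hSo.2 e.2 f.2 fun h' => h (Subtype.ext h')
  have hperp : ∀ e : S, B e v = 0 := fun e => by
    rw [hv, map_sub, hP]
    simp only [Φ, map_sum, map_smul, hon, smul_eq_mul, mul_ite, mul_one, mul_zero,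
      Finset.sum_ite_eq, Finset.mem_univ, if_true, sub_self]
  have hperpP : B P v = 0 := by
    simp only [hP, Φ, map_sum, map_smul, LinearMap.sum_apply, LinearMap.smul_apply, hperp,
      smul_zero, Finset.sum_const_zero]
  have hsum : B φ φ = B P P + B v v := by
    have e : φ = P + v := by rw [hv]; abel
    conv_lhs => rw [e]
    simp only [map_add, LinearMap.add_apply]
    rw [hBs v P, hperpP]; ring
  have hpv : p v ≤ 1 := by
    have h1 : 0 ≤ B P P := by rw [hB]; positivity
    have h2 : p v ^ 2 ≤ 1 := by rw [← hB]; linarith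
    exact (sq_le_one_iff₀ (apply_nonneg p v)).mp h2
  -- If the orthogonal remainder were large for `q`, its normalisation could be added to `S`. When
  -- `p v = 0` no normalisation is possible, but then `q v = 0` by domination.
  have hqv : q v ≤ c := by
    rcases eq_or_lt_of_le (apply_nonneg p v) with h0 | h0
    · exact (hqp v).trans (h0 ▸ hc0.le)
    by_contra hcon
    rw [not_le] at hcon
    set w := (p v)⁻¹ • v with hw
    have hpw : p w = 1 := by
      rw [hw, map_smul_eq_mul, Real.norm_of_nonneg (by positivity), inv_mul_cancel₀ h0.ne']
    have hqw : c ≤ q w := by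
      rw [hw, map_smul_eq_mul, Real.norm_of_nonneg (by positivity)]
      have : (1 : ℝ) ≤ (p v)⁻¹ := (one_le_inv₀ h0).mpr hpv
      nlinarith [apply_nonneg q v]
    have hBw : ∀ e ∈ S, B e w = 0 := fun e he => by
      rw [hw, map_smul, hperp ⟨e, he⟩, smul_zero]
    have hins : insert w S ∈ {S : Set E | p.IsOrthonormalSet S ∧ ∀ e ∈ S, c ≤ q e} := by
      refine ⟨⟨?_, ?_⟩, ?_⟩
      · rintro e (rfl | he)
        · exact hpw
        · exact hSo.1 e he
      · refine hSo.2.insert fun f hf _ => ⟨?_, ?_⟩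
        · rw [hpol, hBs]; exact hBw f hf
        · rw [hpol]; exact hBw f hf
      · rintro e (rfl | he)
        · exact hqw
        · exact hSc e he
    have hwS : w ∈ S := hmax hins (subset_insert w S) (mem_insert w S)
    have h1 := hBw w hwS
    rw [hB, hpw] at h1
    norm_num at h1
  -- The coefficients are bounded by `1` (Bessel for a single vector), so the projection lies in the
  -- compact image covered by the net.
  have hPmem : P ∈ Φ '' Metric.closedBall (0 : S → ℝ) 1 := by
    refine ⟨_, ?_, rfl⟩
    rw [mem_closedBall_zero_iff, pi_norm_le_iff_of_nonneg zero_le_one]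
    intro e
    have h1 : 0 ≤ B (φ - B e φ • (e : E)) (φ - B e φ • (e : E)) := by rw [hB]; positivity
    simp only [map_sub, map_smul, LinearMap.sub_apply, LinearMap.smul_apply, smul_eq_mul,
      hBs φ e, hon, if_true] at h1
    rw [Real.norm_eq_abs]
    exact (sq_le_one_iff_abs_le_one _).mp (by nlinarith)
  obtain ⟨ψ, hψ, hd⟩ := mem_iUnion₂.mp (hcov hPmem)
  refine ⟨ψ, hψ, ?_⟩
  have hd' : q (P - ψ) < c := by
    rw [Metric.mem_ball, dist_eq_norm] at hd; exact hd
  have e : φ - ψ = v + (P - ψ) := by rw [hv]; abel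
  rw [e]
  refine (map_add_le_add q _ _).trans ?_
  linarith

end Nuclear

/-! ### Functionals near a segment. -/

section Functionals

variable {F : Type*} [SeminormedAddCommGroup F] [NormedSpace ℝ F]

theorem ContinuousLinearMap.opNorm_le_of_unitBall {f : F →L[ℝ] ℝ} {C : ℝ} (hC : 0 ≤ C)
    (h : ∀ η, ‖η‖ ≤ 1 → |f η| ≤ C) : ‖f‖ ≤ C :=
  f.opNorm_le_of_unit_norm hC fun η hη => h η hη.le

/-- Hahn-Banach on `F × ℝ`: on the graph of `v`, the functional `u` is dominated by the sublinear
map `ε * ‖η‖ + max 0 r`. For a dominated extension `g`, the points `(0, ±1)` give `0 ≤ g (0, 1) ≤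
1`, and the restriction of `g` to `F` is `u - g (0, 1) • v`, with norm at most `ε`. -/
theorem exists_norm_sub_smul_le {u v : F →L[ℝ] ℝ} {ε : ℝ} (hε : 0 ≤ ε)
    (h : ∀ η, ‖η‖ ≤ 1 → u η ≤ max 0 (v η) + ε) : ∃ a ∈ Icc (0 : ℝ) 1, ‖u - a • v‖ ≤ ε := by
  have hhom : ∀ η, u η ≤ ε * ‖η‖ + max 0 (v η) := fun η => by
    rcases eq_or_lt_of_le (norm_nonneg η) with h0 | h0
    · have h1 := u.le_opNorm η
      rw [← h0, mul_zero] at h1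
      rw [← h0, mul_zero, zero_add]
      exact (le_abs_self _).trans (h1.trans (le_max_left _ _))
    · have h1 := h (‖η‖⁻¹ • η) (by
        rw [norm_smul, norm_inv, norm_norm, inv_mul_cancel₀ h0.ne'])
      rw [map_smul, map_smul, smul_eq_mul, smul_eq_mul] at h1
      have h2 := mul_le_mul_of_nonneg_left h1 h0.le
      rw [mul_add, mul_max_of_nonneg _ _ h0.le, mul_zero, mul_inv_cancel_left₀ h0.ne',
        mul_inv_cancel_left₀ h0.ne'] at h2
      linarith
  let f : F × ℝ →ₗ.[ℝ] ℝ :=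
    { domain := (v : F →ₗ[ℝ] ℝ).graph
      toFun := (u : F →ₗ[ℝ] ℝ) ∘ₗ LinearMap.fst ℝ F ℝ ∘ₗ (v : F →ₗ[ℝ] ℝ).graph.subtype }
  obtain ⟨g, hg1, hg2⟩ := exists_extension_of_le_sublinear f
    (fun w => ε * ‖w.1‖ + max 0 w.2)
    (fun c hc w => by
      simp only [Prod.smul_fst, Prod.smul_snd, norm_smul, Real.norm_of_nonneg hc.le, smul_eq_mul]
      rw [mul_add, mul_max_of_nonneg _ _ hc.le, mul_zero]; ring)
    (fun w w' => by
      have h1 := norm_add_le w.1 w'.1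
      have h2 : max 0 (w.2 + w'.2) ≤ max 0 w.2 + max 0 w'.2 := max_le
        (add_nonneg (le_max_left _ _) (le_max_left _ _))
        (add_le_add (le_max_right _ _) (le_max_right _ _))
      simp only [Prod.fst_add, Prod.snd_add]
      nlinarith)
    (fun w => by
      obtain ⟨⟨η, r⟩, hw⟩ := w
      have hr : r = v η := by simpa [f, LinearMap.mem_graph_iff] using hw
      subst hr
      exact hhom η)
  have hgu : ∀ η, u η = g (η, 0) + g (0, 1) * v η := fun η => by
    have h1 := hg1 ⟨(η, v η), by simp [f, LinearMap.mem_graph_iff]⟩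
    change g (η, v η) = u η at h1
    rw [← h1]
    have e : ((η, v η) : F × ℝ) = (η, 0) + v η • ((0 : F), (1 : ℝ)) := by simp
    rw [e, map_add, map_smul, smul_eq_mul, mul_comm]
  refine ⟨g (0, 1), ⟨?_, ?_⟩, ContinuousLinearMap.opNorm_le_bound _ hε fun η => ?_⟩
  · have h1 := hg2 (0, -1)
    have e : ((0 : F), (-1 : ℝ)) = -((0 : F), (1 : ℝ)) := by simp
    rw [e, map_neg] at h1
    simp at h1
    linarith
  · have h1 := hg2 (0, 1)
    simpa using h1
  · have e : (u - g (0, 1) • v) η = g (η, 0) := by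
      simp only [sub_apply, smul_apply, smul_eq_mul, hgu η]
      ring
    rw [e, Real.norm_eq_abs, abs_le]
    have h1 := hg2 (η, 0)
    have h2 := hg2 (-η, 0)
    have e2 : ((-η, 0) : F × ℝ) = -(η, 0) := by simp
    rw [e2, map_neg] at h2
    simp at h1 h2
    constructor <;> linarith

/-- A functional is close to a segment if it is bounded above by the larger one of the end points,
up to a small error on the unit ball. -/
theorem exists_mem_segment_norm_sub_le {f g h : F →L[ℝ] ℝ} {ε : ℝ} (hε : 0 ≤ ε)
    (hm : ∀ η, ‖η‖ ≤ 1 → g η ≤ max (f η) (h η) + ε) : ∃ w ∈ segment ℝ f h, ‖g - w‖ ≤ ε := by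
  obtain ⟨a, ha, hd⟩ := exists_norm_sub_smul_le (u := g - f) (v := h - f) hε fun η hη => by
    have h1 := hm η hη
    have h2 : max (f η) (h η) = f η + max 0 (h η - f η) := by
      rw [← max_add_add_left]; simp
    simp only [sub_apply]
    linarith
  refine ⟨f + a • (h - f), by rw [segment_eq_image']; exact ⟨a, ha, rfl⟩, ?_⟩
  rwa [← sub_sub]

end Functionals


/-! ### The seminorms of the strong dual -/

section StrongDual

variable {E : Type*} [AddCommGroup E] [Module ℝ E] [TopologicalSpace E]

theorem bddAbove_image_abs {B : Set E} (hB : Bornology.IsVonNBounded ℝ B) (f : E →L[ℝ] ℝ) :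
    BddAbove ((fun φ => |f φ|) '' B) := by
  have h := (NormedSpace.isVonNBounded_iff ℝ).mp (hB.image f)
  obtain ⟨C, hC⟩ := h.exists_norm_le
  refine ⟨C, ?_⟩
  rintro _ ⟨φ, hφ, rfl⟩
  exact hC _ (mem_image_of_mem f hφ)

theorem le_dualSeminorm {B : Set E} (hB : Bornology.IsVonNBounded ℝ B) (f : E →L[ℝ] ℝ) {φ : E}
    (hφ : φ ∈ B) : |f φ| ≤ dualSeminorm B f :=
  le_csSup (bddAbove_image_abs hB f) (mem_image_of_mem (fun φ => |f φ|) hφ)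

theorem dualSeminorm_le {B : Set E} {f : E →L[ℝ] ℝ} {C : ℝ} (hC : 0 ≤ C)
    (h : ∀ φ ∈ B, |f φ| ≤ C) : dualSeminorm B f ≤ C :=
  Real.sSup_le (by rintro _ ⟨φ, hφ, rfl⟩; exact h φ hφ) hC

theorem dualSeminorm_nonneg (B : Set E) (f : E →L[ℝ] ℝ) : 0 ≤ dualSeminorm B f :=
  Real.sSup_nonneg (by rintro _ ⟨φ, -, rfl⟩; exact abs_nonneg _)

/-- `dualSeminorm B`, for bounded `B`, as a seminorm. -/
noncomputable def boundedDualSeminorm (B : {B : Set E // Bornology.IsVonNBounded ℝ B}) :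
    Seminorm ℝ (E →L[ℝ] ℝ) :=
  Seminorm.ofSMulLE (dualSeminorm B.1)
    (le_antisymm (dualSeminorm_le le_rfl fun φ _ => by simp) (dualSeminorm_nonneg _ _))
    (fun f g => dualSeminorm_le (add_nonneg (dualSeminorm_nonneg _ _) (dualSeminorm_nonneg _ _))
      fun φ hφ => (abs_add_le (f φ) (g φ)).trans
        (add_le_add (le_dualSeminorm B.2 f hφ) (le_dualSeminorm B.2 g hφ)))
    (fun a f => dualSeminorm_le (mul_nonneg (norm_nonneg a) (dualSeminorm_nonneg _ _))
      fun φ hφ => by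
        change |a * f φ| ≤ _
        rw [abs_mul]
        exact mul_le_mul_of_nonneg_left (le_dualSeminorm B.2 f hφ) (abs_nonneg a))

theorem continuous_boundedDualSeminorm [IsTopologicalAddGroup E] [ContinuousSMul ℝ E]
    (B : {B : Set E // Bornology.IsVonNBounded ℝ B}) : Continuous (boundedDualSeminorm B) := by
  refine Seminorm.continuous' (r := 1) ?_
  filter_upwards [ContinuousLinearMap.eventually_nhds_zero_mapsTo B.2
    (Metric.closedBall_mem_nhds (0 : ℝ) one_pos)] with f hf
  rw [Seminorm.mem_closedBall_zero]
  refine dualSeminorm_le zero_le_one fun φ hφ => ?_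
  have := hf hφ
  rwa [mem_closedBall_zero_iff] at this

end StrongDual

/-! ### Paths in the dual of a countably Hilbertian nuclear space -/

namespace IsCountablyHilbertianNuclear

variable {E : Type*} [AddCommGroup E] [Module ℝ E] [UniformSpace E] [IsUniformAddGroup E]
  {p : ℕ → Seminorm ℝ E} {T : ℝ}

theorem dualInclusion_injective (hE : IsCountablyHilbertianNuclear p) (n : ℕ) :
    Function.Injective (hE.dualInclusion n) := fun _ _ h =>
  ContinuousLinearMap.ext fun φ => congrArg (fun F : E →L[ℝ] ℝ => F φ) h

/-- A pointwise bounded family of functionals is bounded by a multiple of one of the norms. -/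
theorem exists_uniform_bound (hE : IsCountablyHilbertianNuclear p) {ι : Type*}
    (f : ι → E →L[ℝ] ℝ) (hf : ∀ φ, ∃ M, ∀ i, |f i φ| ≤ M) :
    ∃ n C, 0 ≤ C ∧ ∀ i φ, |f i φ| ≤ C * p n φ := by
  have := hE.withSeminorms.continuousSMul
  have := hE.withSeminorms.firstCountableTopology
  have := hE.complete
  have : (uniformity E).IsCountablyGenerated := IsUniformAddGroup.uniformity_countably_generated
  let q : ι → Seminorm ℝ E := fun i => (normSeminorm ℝ ℝ).comp (f i : E →ₗ[ℝ] ℝ)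
  have hqf : ∀ i φ, q i φ = |f i φ| := fun i φ => rfl
  have hbdd : BddAbove (range q) := by
    rw [Seminorm.bddAbove_range_iff]
    intro φ
    obtain ⟨M, hM⟩ := hf φ
    exact ⟨M, by rintro _ ⟨i, rfl⟩; exact hM i⟩
  -- Completeness and first countability make `E` a Baire space, hence barrelled, so the pointwise
  -- finite supremum of continuous seminorms is continuous.
  have hcont : Continuous (⨆ i, q i : Seminorm ℝ E) := by
    rw [Seminorm.coe_iSup_eq hbdd]
    exact Seminorm.continuous_iSup q (fun i => (f i).continuous.norm) hbdd
  obtain ⟨s, C, -, hC⟩ := Seminorm.bound_of_continuous hE.withSeminorms _ hcont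
  obtain ⟨n, hn⟩ := s.exists_le
  refine ⟨n, C, C.2, fun i φ => ?_⟩
  have h1 : q i φ ≤ (⨆ i, q i : Seminorm ℝ E) φ := le_ciSup hbdd i φ
  have h2 : s.sup p ≤ p n := Finset.sup_le fun i hi => hE.monotone (hn i hi)
  calc |f i φ| = q i φ := rfl
    _ ≤ (⨆ i, q i : Seminorm ℝ E) φ := h1
    _ ≤ C • (s.sup p φ) := hC φ
    _ ≤ C * p n φ := mul_le_mul_of_nonneg_left (h2 φ) C.2

/-- The unit ball of `E_m` is totally bounded in `E_n` for some `m > n`. -/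
theorem exists_finite_nets (hE : IsCountablyHilbertianNuclear p) (n : ℕ) :
    ∃ m, n < m ∧ ∀ ε > 0, ∃ F : Set E, F.Finite ∧
      ∀ φ, p m φ ≤ 1 → ∃ ψ ∈ F, p n (φ - ψ) ≤ ε := by
  obtain ⟨m, hm, hs⟩ := hE.hilbertSchmidt n
  exact ⟨m, hm, fun ε hε =>
    Seminorm.exists_finite_net (hE.hilbertian m) (hE.monotone hm.le) hs hε⟩

/-! ### Compact sets of functionals in the negative levels. -/

section Levels

variable {n m : ℕ} {C : ℝ}

/-- Convergence at the finitely many net points controls the whole unit ball of `p m`, since all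
functionals involved share the bound `C * p n`. Using `C + 1` in the net radius avoids dividing by
`0`. -/
theorem tendsto_negHilbert
    (hnet : ∀ ε > 0, ∃ F : Set E, F.Finite ∧ ∀ φ, p m φ ≤ 1 → ∃ ψ ∈ F, p n (φ - ψ) ≤ ε)
    (hC : 0 ≤ C) {ι : Type*} {L : Filter ι} {g : ι → NegHilbert p m} {g₀ : NegHilbert p m}
    (hg : ∀ i, ∀ φ : E, |g i φ| ≤ C * p n φ) (hg₀ : ∀ φ : E, |g₀ φ| ≤ C * p n φ)
    (h : ∀ φ : E, Tendsto (fun i => g i φ) L (𝓝 (g₀ φ))) : Tendsto g L (𝓝 g₀) := by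
  refine Metric.tendsto_nhds.mpr fun ε hε => ?_
  obtain ⟨F, hF, hnet⟩ := hnet (ε / (8 * (C + 1))) (by positivity)
  have hev : ∀ᶠ i in L, ∀ ψ ∈ F, |g i ψ - g₀ ψ| < ε / 4 :=
    (eventually_all_finite hF).mpr fun ψ _ => Metric.tendsto_nhds.mp (h ψ) _ (by linarith)
  filter_upwards [hev] with i hi
  rw [dist_eq_norm]
  refine lt_of_le_of_lt (ContinuousLinearMap.opNorm_le_of_unitBall (C := ε / 2) (by linarith)
    fun (η : E) (hη : p m η ≤ 1) => ?_) (by linarith)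
  obtain ⟨ψ, hψ, hd⟩ := hnet η hη
  have h1 := hg i (η - ψ)
  have h2 := hg₀ (η - ψ)
  have h3 := hi ψ hψ
  have h4 : C * p n (η - ψ) ≤ ε / 8 := by
    calc C * p n (η - ψ) ≤ C * (ε / (8 * (C + 1))) := mul_le_mul_of_nonneg_left hd hC
      _ ≤ (C + 1) * (ε / (8 * (C + 1))) := by gcongr; linarith
      _ = ε / 8 := by field_simp
  change |g i η - g₀ η| ≤ ε / 2
  have e : g i η - g₀ η = g i (η - ψ) - g₀ (η - ψ) + (g i ψ - g₀ ψ) := by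
    have e1 : g i (η - ψ) = g i η - g i ψ := map_sub (g i) η ψ
    have e2 : g₀ (η - ψ) = g₀ η - g₀ ψ := map_sub g₀ η ψ
    rw [e1, e2]; ring
  rw [e]
  refine (abs_add_le _ _).trans ?_
  have h5 := abs_sub (g i (η - ψ)) (g₀ (η - ψ))
  linarith

/-- The functionals bounded by a multiple of `p n`, as a subset of `E₋ₘ`. -/
def levelBall (p : ℕ → Seminorm ℝ E) (n m : ℕ) (C : ℝ) : Set (NegHilbert p m) :=
  {f | ∀ φ : E, |f φ| ≤ C * p n φ}

/-- As in Banach-Alaoglu, an ultrafilter on the set has a pointwise limit, which is linear and obeys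
the same bound. The finite nets upgrade this limit to a norm limit. -/
theorem isCompact_levelBall
    (hnet : ∀ ε > 0, ∃ F : Set E, F.Finite ∧ ∀ φ, p m φ ≤ 1 → ∃ ψ ∈ F, p n (φ - ψ) ≤ ε)
    (hnm : p n ≤ p m) (hC : 0 ≤ C) : IsCompact (levelBall p n m C) := by
  rw [isCompact_iff_ultrafilter_le_nhds]
  intro U hU
  have hU' : ∀ᶠ f in (U : Filter (NegHilbert p m)), f ∈ levelBall p n m C := le_principal_iff.mp hU
  have hlim : ∀ φ : E, ∃ r, Tendsto (fun f : NegHilbert p m => f φ) U (𝓝 r) := fun φ => by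
    have hc : IsCompact (Icc (-(C * p n φ)) (C * p n φ)) := isCompact_Icc
    obtain ⟨r, -, hr⟩ := isCompact_iff_ultrafilter_le_nhds.mp hc
      (U.map fun f : NegHilbert p m => f φ) (by
        rw [Ultrafilter.coe_map, le_principal_iff, mem_map]
        filter_upwards [hU'] with f hf
        exact abs_le.mp (hf φ))
    exact ⟨r, hr⟩
  choose r hr using hlim
  have hrb : ∀ φ, |r φ| ≤ C * p n φ := fun φ =>
    le_of_tendsto (hr φ).abs (by filter_upwards [hU'] with f hf using hf φ)
  let R : PreHilbertLevel p m →ₗ[ℝ] ℝ :=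
    { toFun := r
      map_add' := fun φ ψ => tendsto_nhds_unique (hr _) (((hr φ).add (hr ψ)).congr fun f =>
        (map_add f φ ψ).symm)
      map_smul' := fun a φ => tendsto_nhds_unique (hr _) (((hr φ).const_mul a).congr fun f =>
        (map_smul f a φ).symm) }
  let g₀ : NegHilbert p m := R.mkContinuous C fun φ =>
    (hrb φ).trans (mul_le_mul_of_nonneg_left (hnm φ) hC)
  refine ⟨g₀, hrb, ?_⟩
  have hmem : levelBall p n m C ∈ (U : Filter (NegHilbert p m)) := hU'
  -- The bound is required of every index rather than eventually, so the ultrafilter is restricted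
  -- to the subtype and pushed forward again.
  have h1 := tendsto_negHilbert (p := p) (L := comap (Subtype.val : levelBall p n m C → NegHilbert p m) U)
    (g := fun f => f.1) (g₀ := g₀) hnet hC
    (fun f => f.2) hrb (fun φ => (hr φ).comp tendsto_comap)
  have h2 : map (Subtype.val : levelBall p n m C → NegHilbert p m)
      (comap Subtype.val (U : Filter (NegHilbert p m))) = U :=
    map_comap_of_mem (by rwa [Subtype.range_coe])
  rw [Tendsto, h2] at h1
  exact h1

theorem levelBall_convexComb {f g : NegHilbert p m} (hf : f ∈ levelBall p n m C)
    (hg : g ∈ levelBall p n m C) {a : ℝ} (ha : a ∈ Icc (0 : ℝ) 1) :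
    (1 - a) • f + a • g ∈ levelBall p n m C := fun φ => by
  have h1 := abs_le.mp (hf φ)
  have h2 := abs_le.mp (hg φ)
  change |(1 - a) * f φ + a * g φ| ≤ _
  have ha1 : 0 ≤ 1 - a := by linarith [ha.2]
  rw [abs_le]
  constructor <;> nlinarith [ha.1, mul_le_mul_of_nonneg_left h1.1 ha1,
    mul_le_mul_of_nonneg_left h1.2 ha1, mul_le_mul_of_nonneg_left h2.1 ha.1,
    mul_le_mul_of_nonneg_left h2.2 ha.1]

/-- A càdlàg path in `E'` which is bounded by a multiple of `p n` is a càdlàg path in `E₋ₘ`. -/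
theorem mem_range_pathInclusion (hE : IsCountablyHilbertianNuclear p)
    (hnet : ∀ ε > 0, ∃ F : Set E, F.Finite ∧ ∀ φ, p m φ ≤ 1 → ∃ ψ ∈ F, p n (φ - ψ) ≤ ε)
    (hnm : p n ≤ p m) (hC : 0 ≤ C) {x : CadlagPath T (E →L[ℝ] ℝ)}
    (hx : ∀ t φ, |x t φ| ≤ C * p n φ) : x ∈ range (hE.pathInclusion m) := by
  have := hE.withSeminorms.continuousSMul
  let lift : ∀ f : E →L[ℝ] ℝ, (∀ φ, |f φ| ≤ C * p n φ) → NegHilbert p m := fun f hf =>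
    LinearMap.mkContinuous (E := PreHilbertLevel p m)
      { toFun := fun φ => f φ
        map_add' := fun φ ψ => map_add f φ ψ
        map_smul' := fun a φ => map_smul f a φ } C
      fun φ => (hf φ).trans (mul_le_mul_of_nonneg_left (hnm φ) hC)
  let y : CadlagPath T (NegHilbert p m) :=
    { toFun := fun t => lift (x t) (hx t)
      rightCont := fun t => tendsto_negHilbert hnet hC (fun s => hx s) (hx t) fun φ =>
        ((continuous_eval_const φ).tendsto (x t)).comp (x.rightCont t)
      leftLimits := fun t => by
        rcases eq_or_neBot (𝓝[<] t) with h | h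
        · exact ⟨0, by simp [h]⟩
        obtain ⟨l, hl⟩ := x.leftLimits t
        have hlφ : ∀ φ, Tendsto (fun s => x s φ) (𝓝[<] t) (𝓝 (l φ)) := fun φ =>
          ((continuous_eval_const φ).tendsto l).comp hl
        have hlb : ∀ φ, |l φ| ≤ C * p n φ := fun φ =>
          le_of_tendsto (hlφ φ).abs (Eventually.of_forall fun s => hx s φ)
        exact ⟨lift l hlb, tendsto_negHilbert hnet hC (fun s => hx s) hlb hlφ⟩ }
  exact ⟨y, CadlagPath.ext fun t => ContinuousLinearMap.ext fun φ => rfl⟩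

/-- The set is closed, so it contains left limits, and convex, so it contains the filled jumps. -/
theorem mem_levelBall_of_mem_graph
    (hK : IsCompact (levelBall p n m C)) {x : CadlagPath T (NegHilbert p m)}
    (hx : ∀ t, x t ∈ levelBall p n m C) {w : NegHilbert p m × Icc (0 : ℝ) T} (hw : w ∈ x.graph) :
    w.1 ∈ levelBall p n m C := by
  obtain ⟨a, ha, he⟩ := hw
  rw [he]
  refine levelBall_convexComb ?_ (hx _) ha
  exact hK.isClosed.mem_of_mapClusterPt (mapClusterPt_leftLim x w.2)
    (Eventually.of_forall hx)

end Levels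

end IsCountablyHilbertianNuclear


/-! ### Relative compactness under continuous maps -/

section Image

variable {α β : Type*} {τ : TopologicalSpace α} {σ : TopologicalSpace β} {f : α → β} {A : Set α}

theorem IsCompactIn.image (hf : Continuous[τ, σ] f) (hA : IsCompactIn τ A) :
    IsCompactIn σ (f '' A) :=
  IsCompact.image hA hf

theorem IsCompactIn.isClosed [T2Space α] (hA : IsCompactIn τ A) : IsClosed A :=
  IsCompact.isClosed hA

theorem IsCompactIn.isRelCompactIn [T2Space α] (hA : IsCompactIn τ A) : IsRelCompactIn τ A := by
  rw [IsRelCompactIn, hA.isClosed.closure_eq]; exact hA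

theorem IsRelCompactIn.isCompactIn (hA : IsRelCompactIn τ A) (hc : IsClosed A) :
    IsCompactIn τ A := by
  rwa [IsRelCompactIn, hc.closure_eq] at hA

theorem IsRelCompactIn.image [T2Space β] (hf : Continuous[τ, σ] f) (hA : IsRelCompactIn τ A) :
    IsRelCompactIn σ (f '' A) :=
  have h : IsCompact (f '' closure A) := IsCompact.image hA hf
  h.of_isClosed_subset isClosed_closure (closure_minimal (image_mono subset_closure) h.isClosed)

end Image

/-- The dual norm on `E₋ₙ` separates points, although `p n` need not do so on `E`. -/
noncomputable instance {E : Type*} [AddCommGroup E] [Module ℝ E] (p : ℕ → Seminorm ℝ E) (n : ℕ) :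
    NormedAddCommGroup (NegHilbert p n) :=
  { (inferInstance : SeminormedAddCommGroup (NegHilbert p n)) with
    eq_of_dist_eq_zero := fun {f g} h => by
      rw [dist_eq_norm] at h
      refine ContinuousLinearMap.ext fun φ => sub_eq_zero.mp (norm_le_zero_iff.mp ?_)
      simpa [h] using (f - g).le_opNorm φ }

/-! ### Transfer between the strong dual, its levels and the real projections. -/

namespace IsCountablyHilbertianNuclear

variable {E : Type*} [AddCommGroup E] [Module ℝ E] [UniformSpace E] [IsUniformAddGroup E]
  {p : ℕ → Seminorm ℝ E} {T : ℝ}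

/-- Every càdlàg path in the strong dual has an arc. -/
theorem exists_isArc (hE : IsCountablyHilbertianNuclear p) (hT : 0 < T)
    (x : CadlagPath T (E →L[ℝ] ℝ)) : ∃ l, x.IsArc l := by
  have := hE.withSeminorms.continuousSMul
  -- Each evaluation of the path is a real càdlàg path, hence bounded. The whole path is then
  -- bounded by one norm, lifts to some `E₋ₘ`, and its arc there is mapped back injectively.
  obtain ⟨n, C, hC, hb⟩ := hE.exists_uniform_bound (fun t => x t) fun φ => by
    obtain ⟨M, -, hM⟩ := (hE.proj φ x).exists_bound_of_m1Dist_lt hT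
    exact ⟨M, hM _ (by
      rw [m1Dist_self _ (((hE.proj φ x).exists_isArc hT).imp fun _ h => h.1)]; exact one_pos)⟩
  obtain ⟨m, hm, hnet⟩ := hE.exists_finite_nets n
  obtain ⟨y, rfl⟩ := hE.mem_range_pathInclusion hnet (hE.monotone hm.le) hC hb
  obtain ⟨l, hl⟩ := y.exists_isArc hT
  exact ⟨_, hl.map (hE.dualInclusion m).continuous (hE.dualInclusion m).isLinear
    (hE.dualInclusion_injective m)⟩

theorem continuous_proj (hE : IsCountablyHilbertianNuclear p) (hT : 0 < T) (φ : E) :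
    Continuous[m1TopologyDual T E, m1TopologyNormed T ℝ] (hE.proj (T := T) φ) := by
  have := hE.withSeminorms.continuousSMul
  have hB : Bornology.IsVonNBounded ℝ {φ} := Bornology.isVonNBounded_singleton φ
  exact continuous_map_m1Topology (q := boundedDualSeminorm (E := E))
    (q' := fun _ : Unit => normSeminorm ℝ ℝ) continuous_boundedDualSeminorm
    (fun _ => by exact continuous_norm) (fun x => (hE.exists_isArc hT x).imp fun _ h => h.1)
    (fun y => y.exists_isArc hT) (continuous_eval_const φ) ⟨fun _ _ => rfl, fun _ _ => rfl⟩
    fun _ => ⟨⟨{φ}, hB⟩, 1, le_rfl, fun f => by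
      rw [one_mul]; exact le_dualSeminorm hB f (mem_singleton φ)⟩

/-- A bounded subset of `E` is bounded for `p n`, so its seminorm on `E₋ₙ` is at most a multiple of
the dual norm. -/
theorem continuous_pathInclusion (hE : IsCountablyHilbertianNuclear p) (hT : 0 < T) (n : ℕ) :
    Continuous[m1TopologyNormed T (NegHilbert p n), m1TopologyDual T E]
      (hE.pathInclusion (T := T) n) := by
  have := hE.withSeminorms.continuousSMul
  have := hE.hausdorff
  refine continuous_map_m1Topology (q := fun _ : Unit => normSeminorm ℝ (NegHilbert p n))
    (q' := boundedDualSeminorm (E := E)) (fun _ => by exact continuous_norm)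
    continuous_boundedDualSeminorm (fun x => (x.exists_isArc hT).imp fun _ h => h.1)
    (hE.exists_isArc hT) (hE.dualInclusion n).continuous (hE.dualInclusion n).isLinear fun B => ?_
  obtain ⟨r, hr, hB⟩ := (hE.withSeminorms.isVonNBounded_iff_seminorm_bounded).mp B.2 n
  refine ⟨(), max 1 r, le_max_left _ _, fun f => ?_⟩
  have hr0 : 0 ≤ max 1 r := zero_le_one.trans (le_max_left _ _)
  refine dualSeminorm_le (mul_nonneg hr0 (norm_nonneg f)) fun φ hφ => ?_
  calc |f φ| ≤ ‖f‖ * p n φ := f.le_opNorm φ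
    _ ≤ ‖f‖ * max 1 r := by
      gcongr
      exact (hB φ hφ).le.trans (le_max_right _ _)
    _ = max 1 r * ‖f‖ := mul_comm _ _

/-- Evaluations at test points separate paths and are continuous into a Hausdorff space. -/
theorem t2Space_m1TopologyDual (hE : IsCountablyHilbertianNuclear p) (hT : 0 < T) :
    @T2Space _ (m1TopologyDual T E) := by
  let := m1TopologyDual T E
  let := m1TopologyNormed T ℝ
  have : T2Space (CadlagPath T ℝ) := t2Space_m1TopologyNormed hT
  refine ⟨fun x y hxy => ?_⟩
  have hφ : ∃ φ, hE.proj φ x ≠ hE.proj φ y := by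
    by_contra h
    push Not at h
    exact hxy (CadlagPath.ext fun t => ContinuousLinearMap.ext fun φ =>
      congrArg (fun z : CadlagPath T ℝ => z t) (h φ))
  obtain ⟨φ, hφ⟩ := hφ
  obtain ⟨U, V, hU, hV, hxU, hyV, hd⟩ := t2_separation hφ
  exact ⟨_, _, hU.preimage (hE.continuous_proj hT φ), hV.preimage (hE.continuous_proj hT φ),
    hxU, hyV, hd.preimage _⟩

/-- Curves with uniformly bounded values in `E₋ₙ` whose evaluations at finitely many test points
have small oscillations, have small oscillations in `E₋ₘ`. -/
theorem segOsc_startOsc_of_net {n m : ℕ} {C δ ε : ℝ} (hC : 0 ≤ C) (hε : 0 < ε) {F : Set E}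
    (hnet : ∀ φ, p m φ ≤ 1 → ∃ ψ ∈ F, p n (φ - ψ) ≤ ε / (8 * (C + 1)))
    {l : Icc (0 : ℝ) 1 → NegHilbert p m × Icc (0 : ℝ) T}
    (hl : ∀ s, ∀ φ : E, |(l s).1 φ| ≤ C * p n φ)
    (hosc : ∀ ψ ∈ F, UpperOsc (fun s => ((l s).1 ψ, (l s).2)) δ (ε / 4) ∧
      StartOsc (fun s => ((l s).1 ψ, (l s).2)) δ (ε / 4)) :
    SegOsc l δ ε ∧ StartOsc l δ ε := by
  have key : ∀ η : E, p m η ≤ 1 → ∃ ψ ∈ F, ∀ s, |(l s).1 η - (l s).1 ψ| ≤ ε / 8 := fun η hη => by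
    obtain ⟨ψ, hψ, hd⟩ := hnet η hη
    refine ⟨ψ, hψ, fun s => ?_⟩
    have e : (l s).1 η - (l s).1 ψ = (l s).1 (η - ψ : E) := (map_sub (l s).1 η ψ).symm
    rw [e]
    calc |(l s).1 (η - ψ : E)| ≤ C * p n (η - ψ) := hl s _
      _ ≤ C * (ε / (8 * (C + 1))) := mul_le_mul_of_nonneg_left hd hC
      _ ≤ (C + 1) * (ε / (8 * (C + 1))) := by gcongr; linarith
      _ = ε / 8 := by field_simp
  constructor
  · intro s₁ s₂ s₃ h12 h23 ht
    -- Hahn-Banach reduces closeness to the segment to scalar upper bounds on the unit ball, for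
    -- which the one-sided modulus at a nearby net point suffices.
    refine exists_mem_segment_norm_sub_le hε.le fun (η : E) (hη : p m η ≤ 1) => ?_
    obtain ⟨ψ, hψ, hd⟩ := key η hη
    have h0 : (l s₂).1 ψ ≤ max ((l s₁).1 ψ) ((l s₃).1 ψ) + ε / 4 :=
      (hosc ψ hψ).1 s₁ s₂ s₃ h12 h23 ht
    have h1 := abs_le.mp (hd s₁)
    have h2 := abs_le.mp (hd s₂)
    have h3 := abs_le.mp (hd s₃)
    have h4 : max ((l s₁).1 ψ) ((l s₃).1 ψ) ≤ max ((l s₁).1 η) ((l s₃).1 η) + ε / 8 :=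
      max_le (by linarith [le_max_left ((l s₁).1 η) ((l s₃).1 η)])
        (by linarith [le_max_right ((l s₁).1 η) ((l s₃).1 η)])
    linarith
  · intro s hs
    refine ContinuousLinearMap.opNorm_le_of_unitBall hε.le fun (η : E) (hη : p m η ≤ 1) => ?_
    change |(l s).1 η - (l 0).1 η| ≤ ε
    obtain ⟨ψ, hψ, hd⟩ := key η hη
    have h0 : |(l s).1 ψ - (l 0).1 ψ| ≤ ε / 4 := (hosc ψ hψ).2 s hs
    have h1 := abs_le.mp (hd s)
    have h2 := abs_le.mp (hd 0)
    rw [abs_le] at h0 ⊢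
    constructor <;> linarith [h0.1, h0.2]

/-- Banach-Steinhaus selects `n` and nuclearity selects `m`. Compact values and the scalar moduli at
a finite net then verify the compactness criterion in `E₋ₘ`. -/
theorem exists_isRelCompactIn_level (hE : IsCountablyHilbertianNuclear p) (hT : 0 < T)
    {A : Set (CadlagPath T (E →L[ℝ] ℝ))}
    (hA : ∀ φ : E, IsRelCompactIn (m1TopologyNormed T ℝ) (hE.proj φ '' A)) :
    ∃ m : ℕ, A ⊆ range (hE.pathInclusion m) ∧
      IsRelCompactIn (m1TopologyNormed T (NegHilbert p m)) (hE.pathInclusion m ⁻¹' A) := by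
  obtain ⟨n, C, hC, hb⟩ := hE.exists_uniform_bound
    (fun i : A × Icc (0 : ℝ) T => i.1.1 i.2) fun φ => by
      obtain ⟨M, hM⟩ := (hA φ).exists_bound hT
      exact ⟨M, fun i => hM _ (mem_image_of_mem _ i.1.2) i.2⟩
  obtain ⟨m, hm, hnet⟩ := hE.exists_finite_nets n
  have hK := isCompact_levelBall hnet (hE.monotone hm.le) hC
  have hAK : ∀ x ∈ hE.pathInclusion (T := T) m ⁻¹' A, ∀ t, x t ∈ levelBall p n m C :=
    fun x hx t φ => hb (⟨_, hx⟩, t) φ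
  refine ⟨m, fun x hx => hE.mem_range_pathInclusion hnet (hE.monotone hm.le) hC
    fun t φ => hb (⟨x, hx⟩, t) φ, isRelCompactIn_m1TopologyNormed hT hK hAK fun ε hε => ?_⟩
  obtain ⟨F, hF, hnetF⟩ := hnet (ε / (8 * (C + 1))) (by positivity)
  have hev : ∀ ψ ∈ F, ∀ᶠ δ in 𝓝[>] (0 : ℝ), ∀ y ∈ hE.proj (T := T) ψ '' A, ∀ l ∈ y.paramReps,
      UpperOsc l δ (ε / 4) ∧ StartOsc l δ (ε / 4) := fun ψ _ => by
    obtain ⟨δ, hδ, h⟩ := (hA ψ).exists_upperOsc hT (show 0 < ε / 4 by linarith)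
    filter_upwards [Ioo_mem_nhdsGT hδ] with δ' hδ' y hy l hl
    exact ⟨(h y hy l hl).1.mono hδ'.2.le, (h y hy l hl).2.mono hδ'.2.le⟩
  obtain ⟨δ, hδ, hδ0⟩ := (((eventually_all_finite hF).mpr hev).and self_mem_nhdsWithin).exists
  refine ⟨δ, hδ0, fun x hx l hl => segOsc_startOsc_of_net hC hε hnetF (fun s => ?_) fun ψ hψ => ?_⟩
  · exact mem_levelBall_of_mem_graph hK (hAK x hx) (by rw [← hl.1.2.1]; exact mem_range_self s)
  -- Evaluating an arc at `ψ` may destroy injectivity, so the scalar moduli are needed for all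
  -- parametric representations.
  · have hmem := CadlagPath.map_mem_paramReps
      (f := fun g : NegHilbert p m => g (show PreHilbertLevel p m from ψ))
      (continuous_eval_const (show PreHilbertLevel p m from ψ))
      ⟨fun _ _ => rfl, fun _ _ => rfl⟩ hl.1
    exact hδ ψ hψ _ (mem_image_of_mem _ hx) _ hmem

end IsCountablyHilbertianNuclear

theorem theorem3p1 {E : Type*} [AddCommGroup E] [Module ℝ E] [UniformSpace E]
    [IsUniformAddGroup E] {p : ℕ → Seminorm ℝ E} (hE : IsCountablyHilbertianNuclear p)
    {T : ℝ} (hT : 0 < T) (A : Set (CadlagPath T (E →L[ℝ] ℝ))) :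
    List.TFAE [
      IsRelCompactIn (m1TopologyDual T E) A,
      ∀ φ : E, IsRelCompactIn (m1TopologyNormed T ℝ) (hE.proj φ '' A),
      ∃ n : ℕ, A ⊆ Set.range (hE.pathInclusion n) ∧
        IsRelCompactIn (m1TopologyNormed T (NegHilbert p n)) (hE.pathInclusion n ⁻¹' A)] ∧
    List.TFAE [
      IsCompactIn (m1TopologyDual T E) A,
      IsClosed[m1TopologyDual T E] A ∧
        ∀ φ : E, IsCompactIn (m1TopologyNormed T ℝ) (hE.proj φ '' A),
      ∃ n : ℕ, A ⊆ Set.range (hE.pathInclusion n) ∧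
        IsCompactIn (m1TopologyNormed T (NegHilbert p n)) (hE.pathInclusion n ⁻¹' A)] := by
  have t2D := hE.t2Space_m1TopologyDual hT
  have t2R := t2Space_m1TopologyNormed (X := ℝ) hT
  have h12 : IsRelCompactIn (m1TopologyDual T E) A →
      ∀ φ : E, IsRelCompactIn (m1TopologyNormed T ℝ) (hE.proj φ '' A) :=
    fun h φ => IsRelCompactIn.image (hE.continuous_proj hT φ) h
  have h31 : (∃ n : ℕ, A ⊆ Set.range (hE.pathInclusion n) ∧
      IsRelCompactIn (m1TopologyNormed T (NegHilbert p n)) (hE.pathInclusion n ⁻¹' A)) →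
      IsRelCompactIn (m1TopologyDual T E) A := by
    rintro ⟨n, hn, h⟩
    have := IsRelCompactIn.image (hE.continuous_pathInclusion hT n) h
    rwa [image_preimage_eq_of_subset hn] at this
  constructor
  · tfae_have 1 → 2 := h12
    tfae_have 2 → 3 := hE.exists_isRelCompactIn_level hT
    tfae_have 3 → 1 := h31
    tfae_finish
  · tfae_have 1 → 2 := fun h => ⟨IsCompactIn.isClosed h,
      fun φ => IsCompactIn.image (hE.continuous_proj hT φ) h⟩
    tfae_have 2 → 3 := fun ⟨hc, h⟩ => by
      obtain ⟨n, hn, hr⟩ := hE.exists_isRelCompactIn_level hT fun φ =>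
        IsCompactIn.isRelCompactIn (h φ)
      -- Closedness of `A` in the strong dual passes to its preimage in the level, where relative
      -- compactness then becomes compactness.
      exact ⟨n, hn, IsRelCompactIn.isCompactIn hr
        (@IsClosed.preimage _ _
        (m1TopologyNormed T (NegHilbert p n)) (m1TopologyDual T E) _
        (hE.continuous_pathInclusion hT n) _ hc)⟩
    tfae_have 3 → 1 := by
      rintro ⟨n, hn, h⟩
      have := IsCompactIn.image (hE.continuous_pathInclusion hT n) h
      rwa [image_preimage_eq_of_subset hn] at this
    tfae_finish
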